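/- Let $X$ be a $2$-dimensional real normed space with closed unit ball $BX=\{x\in X:\|x\|\le 1\}$. A set $S\subset X$ is called well-distributed if there is a constant $K$ such that for every $x\in X$ there is $y\in S$ with $\|x-y\|\le K$. For a positive integer $N$ put $\Delta_{X,N}(S)=\{\|a-a'\| : a,a'\in S,\ \|a-a'\|\le N\}$. Given a basis $e_1,e_2$ of $X$, with coordinates $x=x_1e_1+x_2e_2$, the slope of a non-degenerate segment lying on the line $u_1x_1+u_2x_2+u_0=0$, $(u_1,u_2)\neq(0,0)$, is $-u_1/u_2$ if $u_2\neq 0$, and $\infty$ if $u_2=0$; by convention, the slope $\infty$ is regarded as algebraic. The following two conditions are equivalent: (i) $BX$ is a polygon with finitely many sides, and there is a basis $e_1,e_2$ of $X$ in whose coordinates the slopes of all sides of $BX$ are algebraic (over $\mathbb{Q}$); (ii) there is a well-distributed set $S\subset X$ such that all the sets $\Delta_{X,N}(S)$ are finite and $|\Delta_{X,N}(S)|=O(N)$ as $N\to\infty$ (the implied constant may depend on $X$ and $S$). -/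

import Mathlib

open Filter Topology Asymptotics

/-- `P` is a (convex, non-degenerate) polygon with finitely many sides: the convex hull of a finite
set of points, with non-empty interior. Used in two-dimensional spaces. -/
def IsFinitePolygon {X : Type*} [NormedAddCommGroup X] [NormedSpace ℝ X] (P : Set X) : Prop :=
  (∃ V : Set X, V.Finite ∧ P = convexHull ℝ V) ∧ (interior P).Nonempty

/-- `I` is a side of the planar convex set `P`: a non-degenerate segment contained in the boundary
of `P` which is not properly contained in another segment in the boundary of `P`. -/
def IsSide {X : Type*} [NormedAddCommGroup X] [NormedSpace ℝ X] (P I : Set X) : Prop :=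
  (∃ p q : X, p ≠ q ∧ I = segment ℝ p q) ∧ I ⊆ frontier P ∧
    ∀ p q : X, I ⊆ segment ℝ p q → segment ℝ p q ⊆ frontier P → segment ℝ p q = I

open Classical in
/-- The slope `-u₁ / u₂` of the line `u₁ x₁ + u₂ x₂ + u₀ = 0`, where `(u₁, u₂) ≠ (0, 0)`; it is `∞`
if `u₂ = 0`. -/
noncomputable def lineSlope (u₁ u₂ : ℝ) : OnePoint ℝ :=
  if u₂ = 0 then OnePoint.infty else ((-u₁ / u₂ : ℝ) : OnePoint ℝ)

/-- In the coordinates `x = x₁ e₁ + x₂ e₂` given by the basis `e`, the (non-degenerate) segment `I`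
has slope `s`: it lies on a line `u₁ x₁ + u₂ x₂ + u₀ = 0` of slope `s`. -/
def HasSlope {X : Type*} [NormedAddCommGroup X] [NormedSpace ℝ X]
    (e : Module.Basis (Fin 2) ℝ X) (I : Set X) (s : OnePoint ℝ) : Prop :=
  ∃ u₁ u₂ u₀ : ℝ, (u₁ ≠ 0 ∨ u₂ ≠ 0) ∧
    (∀ x ∈ I, u₁ * e.repr x 0 + u₂ * e.repr x 1 + u₀ = 0) ∧ s = lineSlope u₁ u₂

/-- A slope is algebraic if it is a real number algebraic over `ℚ`, or `∞`. -/
def IsAlgebraicSlope (s : OnePoint ℝ) : Prop :=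
  s = OnePoint.infty ∨ ∃ r : ℝ, s = (r : OnePoint ℝ) ∧ IsAlgebraic ℚ r

/-- `S` is a `K`-net for `X` for some `K`. -/
def IsWellDistributed {X : Type*} [NormedAddCommGroup X] (S : Set X) : Prop :=
  ∃ K : ℝ, ∀ x : X, ∃ y ∈ S, ‖x - y‖ ≤ K

/-- The set of distances, at most `N`, between points of `S`. -/
def distanceSet {X : Type*} [NormedAddCommGroup X] (S : Set X) (N : ℕ) : Set ℝ :=
  {t : ℝ | t ≤ N ∧ ∃ a ∈ S, ∃ a' ∈ S, t = ‖a - a'‖}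

/-- `|Δ_N(S)| = O(N)` as `N → ∞`, where all `Δ_N(S)` are finite. -/
def HasLinearDistanceGrowth {X : Type*} [NormedAddCommGroup X] (S : Set X) : Prop :=
  (∀ N : ℕ, (distanceSet S N).Finite) ∧
    (fun N : ℕ => ((distanceSet S N).ncard : ℝ)) =O[atTop] (fun N : ℕ => (N : ℝ))

/-!
A set with linearly many distances forces strong rigidity on the norm, in three steps.

*The ball is a polygon.* Where the norm is differentiable, with derivative `f` at `u`, a centre
`c = t • u + O(1)` with `t` large sees two fixed points `a, a'` of `S` at nearly equal distances
whose difference is almost `f (a - a')`. If `f (a - a')` took `q ^ 2` values as `u` varies, then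
every far window of fixed radius would contain at least `q` distances, which linear growth bounds
(`LinearGrowth.window_le`, `finite_image_normDerivatives`). As `S - S` spans the space, the norm
has finitely many derivatives. By Rademacher's theorem it is differentiable almost everywhere, so
it is the maximum of these finitely many functionals (`isNormingSet_normDerivatives`), and its
unit ball is a polygon (`IsNormingSet.isFinitePolygon`).

*Differences are locally finite.* Each such functional `f` agrees with the norm on a cone around
some `u`. If `A` and `B` are the sets of values of `f` on `S` in a ball of radius `T` and in its
translate far out in the direction `u`, then `B - A` consists of `O(T)` distances, so Plünnecke's
inequality gives `|A + A - A| = O(T)`. Bounded elements of `A - A` have distinct sums with the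
elements of a separated subset of `A` of size proportional to `T`, so there are `O(1)` of them,
uniformly in `T` (`IsNormOnCone.finite_differences`).

*Slopes are algebraic.* In coordinates where three of the functionals are `x₁`, `x₂`, `x₁ + x₂`,
let `a t` be the first coordinate of a point of `S` near `(t, 0)`. The local finiteness for these
three functionals and for a fourth one, `γ x₁ + δ x₂`, shows that `μ * a t - a (μ * t)` takes
finitely many values for `μ = γ / δ`. By pigeonhole there are `t, t'` such that
`μ ^ j * (a t - a t')` lies in the group generated by the differences of `a` for `j` up to any given bound. This
group is finitely generated, so `μ` is algebraic (`isAlgebraic_of_almost_dilation`).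

Conversely, the norm of a polygonal plane is a maximum of functionals, one for each side, so that
each is a real multiple of `α x₁ + β x₂` with `α, β` algebraic. Let `K ⊆ ℝ` be the number field
generated by all `α, β`, and let `S` consist of the points whose coordinates are integers of `K`
with bounded conjugates. Then `S` is a net, because the integers of `K` form a lattice in the
mixed space (`exists_integer_near`). Every distance is, up to finitely many factors, an integer
of `K` with bounded other conjugates, and there are `O(N)` such integers in `[-N, N]`
(`exists_integer_count`).
-/

/-! ### Sets of linear growth -/

/-- The set of all distances between points of `S`. -/
def allDistances {X : Type*} [NormedAddCommGroup X] (S : Set X) : Set ℝ :=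
  {t : ℝ | ∃ a ∈ S, ∃ a' ∈ S, t = ‖a - a'‖}

theorem distanceSet_eq {X : Type*} [NormedAddCommGroup X] (S : Set X) (N : ℕ) :
    distanceSet S N = allDistances S ∩ Set.Iic (N : ℝ) := by
  ext t
  simp only [distanceSet, allDistances, Set.mem_ofPred_eq, Set.mem_inter_iff, Set.mem_Iic]
  tauto

/-- A set of reals with at most `C * N` elements in `(-∞, N]`, for every positive integer `N`. -/
def LinearGrowth (D : Set ℝ) (C : ℝ) : Prop :=
  ∀ N : ℕ, 1 ≤ N → (D ∩ Set.Iic (N : ℝ)).Finite ∧ ((D ∩ Set.Iic (N : ℝ)).ncard : ℝ) ≤ C * N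

theorem HasLinearDistanceGrowth.exists_linearGrowth {X : Type*} [NormedAddCommGroup X] {S : Set X}
    (h : HasLinearDistanceGrowth S) : ∃ C : ℝ, 0 < C ∧ LinearGrowth (allDistances S) C := by
  obtain ⟨hfin, hO⟩ := h
  obtain ⟨c, hc⟩ := hO.bound
  obtain ⟨N₀, hN₀⟩ := eventually_atTop.1 hc
  set M : ℝ := ∑ N ∈ Finset.range N₀, ((distanceSet S N).ncard : ℝ) with hM
  have hM0 : 0 ≤ M := Finset.sum_nonneg fun _ _ => Nat.cast_nonneg _
  refine ⟨|c| + M + 1, by positivity, fun N hN => ?_⟩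
  rw [← distanceSet_eq]
  refine ⟨hfin N, ?_⟩
  have hN1 : (1 : ℝ) ≤ N := by exact_mod_cast hN
  rcases lt_or_ge N N₀ with h | h
  · have : ((distanceSet S N).ncard : ℝ) ≤ M :=
      Finset.single_le_sum (f := fun N => ((distanceSet S N).ncard : ℝ))
        (fun _ _ => Nat.cast_nonneg _) (Finset.mem_range.2 h)
    nlinarith [abs_nonneg c]
  · have := hN₀ N h
    simp only [Real.norm_natCast] at this
    nlinarith [le_abs_self c]

theorem LinearGrowth.finite {D : Set ℝ} {C : ℝ} (h : LinearGrowth D C) (x : ℝ) :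
    (D ∩ Set.Iic x).Finite := by
  refine (h (⌈x⌉₊ + 1) (by omega)).1.subset
    (Set.inter_subset_inter_right _ (Set.Iic_subset_Iic.2 ?_))
  push_cast
  linarith [Nat.le_ceil x]

theorem LinearGrowth.ncard_le {D : Set ℝ} {C : ℝ} (hC : 0 ≤ C) (h : LinearGrowth D C) {x : ℝ}
    (hx : 0 ≤ x) : ((D ∩ Set.Iic x).ncard : ℝ) ≤ C * (x + 2) := by
  obtain ⟨h1, h2⟩ := h (⌈x⌉₊ + 1) (by omega)
  have h3 : D ∩ Set.Iic x ⊆ D ∩ Set.Iic ((⌈x⌉₊ + 1 : ℕ) : ℝ) := by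
    refine Set.inter_subset_inter_right _ (Set.Iic_subset_Iic.2 ?_)
    push_cast
    linarith [Nat.le_ceil x]
  have h4 : ((D ∩ Set.Iic x).ncard : ℝ) ≤ _ := Nat.cast_le.2 (Set.ncard_le_ncard h3 h1)
  refine h4.trans (h2.trans (mul_le_mul_of_nonneg_left ?_ hC))
  push_cast
  linarith [Nat.ceil_lt_add_one hx]

/-- A set of linear growth cannot have many elements in every far window of fixed radius. -/
theorem LinearGrowth.window_le {D : Set ℝ} {C : ℝ} (hC : 0 ≤ C) (h : LinearGrowth D C) {k T : ℝ}
    (hk : 0 ≤ k) (hT : 0 ≤ T) {q : ℕ}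
    (hq : ∀ t, T ≤ t → q ≤ (D ∩ Set.Icc (t - k) (t + k)).ncard) : (q : ℝ) ≤ C * (2 * k + 1) := by
  have key : ∀ J : ℕ, q * J ≤ (D ∩ Set.Iic (T + k + (2 * k + 1) * J)).ncard := by
    intro J
    induction J with
    | zero => simp
    | succ J ih =>
      have h1 := hq (T + (2 * k + 1) * (J + 1)) (by nlinarith [(Nat.cast_nonneg J : (0 : ℝ) ≤ J)])
      set t := T + (2 * k + 1) * ((J : ℝ) + 1) with ht
      have hdisj : Disjoint (D ∩ Set.Iic (T + k + (2 * k + 1) * J))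
          (D ∩ Set.Icc (t - k) (t + k)) := by
        rw [Set.disjoint_left]
        rintro x ⟨-, hx⟩ ⟨-, hx', -⟩
        simp only [Set.mem_Iic] at hx
        have : t = T + (2 * k + 1) * J + (2 * k + 1) := by rw [ht]; ring
        linarith
      have hsub : (D ∩ Set.Iic (T + k + (2 * k + 1) * J)) ∪ (D ∩ Set.Icc (t - k) (t + k)) ⊆
          D ∩ Set.Iic (T + k + (2 * k + 1) * (J + 1 : ℕ)) := by
        rw [← Set.inter_union_distrib_left]
        refine Set.inter_subset_inter_right _ ?_
        rintro x (hx | ⟨-, hx⟩)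
        · simp only [Set.mem_Iic] at hx ⊢
          push_cast
          nlinarith
        · simp only [Set.mem_Iic]
          push_cast
          rw [ht] at hx
          linarith
      have h2 := Set.ncard_le_ncard hsub (h.finite _)
      rw [Set.ncard_union_eq hdisj (h.finite _)
        ((h.finite (t + k)).subset (Set.inter_subset_inter_right _ fun x hx => hx.2))] at h2
      calc q * (J + 1) = q * J + q := by ring
        _ ≤ _ := by omega
  by_contra! hlt
  obtain ⟨J, hJ⟩ := exists_nat_gt (C * (T + k + 2) / (q - C * (2 * k + 1)))
  rw [div_lt_iff₀ (by linarith)] at hJ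
  have h1 : ((q * J : ℕ) : ℝ) ≤ _ := Nat.cast_le.2 (key J)
  have h2 := h1.trans (h.ncard_le hC (by positivity))
  push_cast at h2
  nlinarith

/-! ### Derivatives of the norm and polygonality of the ball -/

section
variable {X : Type*} [NormedAddCommGroup X] [NormedSpace ℝ X]

/-- The derivatives of the norm at unit vectors, where they exist. -/
def normDerivatives (X : Type*) [NormedAddCommGroup X] [NormedSpace ℝ X] : Set (X →L[ℝ] ℝ) :=
  {f | ∃ u : X, ‖u‖ = 1 ∧ HasFDerivAt (fun x : X => ‖x‖) f u}

theorem norm_asymptotics {f : X →L[ℝ] ℝ} {u : X} (hf : HasFDerivAt (fun x : X => ‖x‖) f u)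
    (R : ℝ) {ε : ℝ} (hε : 0 < ε) :
    ∃ T : ℝ, 0 < T ∧ ∀ t, T ≤ t → ∀ h : X, ‖h‖ ≤ R → |‖t • u + h‖ - t * ‖u‖ - f h| ≤ ε := by
  have hR : 0 < |R| + 1 := by positivity
  have h1 := (hasFDerivAt_iff_isLittleO_nhds_zero.1 hf).def (div_pos hε hR)
  obtain ⟨δ, hδ, hball⟩ := Metric.eventually_nhds_iff.1 h1
  refine ⟨(|R| + 1) / δ + 1, by positivity, fun t ht h hh => ?_⟩
  have ht0 : 0 < t := lt_of_lt_of_le (by positivity) ht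
  have hhR : ‖h‖ < |R| + 1 := by linarith [le_abs_self R]
  have hk : dist (t⁻¹ • h) 0 < δ := by
    rw [dist_zero_right, norm_smul, norm_inv, Real.norm_of_nonneg ht0.le, inv_mul_lt_iff₀ ht0]
    have : (|R| + 1) / δ < t := by linarith
    rw [div_lt_iff₀ hδ] at this
    linarith
  have h2 := hball hk
  simp only [map_smul, smul_eq_mul] at h2
  have e1 : ‖t • u + h‖ = t * ‖u + t⁻¹ • h‖ := by
    rw [← Real.norm_of_nonneg ht0.le, ← norm_smul, smul_add, smul_smul,
      Real.norm_of_nonneg ht0.le, mul_inv_cancel₀ ht0.ne', one_smul]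
  have e2 : ‖t • u + h‖ - t * ‖u‖ - f h = t * (‖u + t⁻¹ • h‖ - ‖u‖ - t⁻¹ * f h) := by
    rw [e1]; field_simp
  rw [e2, abs_mul, abs_of_pos ht0]
  rw [Real.norm_eq_abs, norm_smul, norm_inv, Real.norm_of_nonneg ht0.le] at h2
  calc t * _ ≤ t * (ε / (|R| + 1) * (t⁻¹ * ‖h‖)) := by gcongr
    _ = ε * (‖h‖ / (|R| + 1)) := by field_simp
    _ ≤ ε * 1 := by gcongr; rw [div_le_one hR]; exact hhR.le
    _ = ε := mul_one _

/-- Far centres of `S` in the direction of a smooth point `u` of the norm see the difference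
`a - a'` as a difference of two nearby distances, approximately `f (a - a')`. The number of elements
in a window of distances bounds the number of differences. -/
theorem finite_image_normDerivatives {S : Set X} {K C : ℝ} (hK : ∀ x : X, ∃ y ∈ S, ‖x - y‖ ≤ K)
    (hC : 0 ≤ C) (hD : LinearGrowth (allDistances S) C) {a a' : X} (ha : a ∈ S) (ha' : a' ∈ S) :
    ((fun f : X →L[ℝ] ℝ => f (a - a')) '' normDerivatives X).Finite := by
  by_contra hinf
  have hK0 : 0 ≤ K := by
    obtain ⟨y, -, hy⟩ := hK 0
    exact (norm_nonneg _).trans hy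
  set w := a - a' with hw
  set k := K + ‖w‖ with hk
  obtain ⟨q, hq⟩ := exists_nat_gt (C * (2 * k + 1))
  obtain ⟨V, hV, hVcard⟩ := Set.Infinite.exists_subset_card_eq hinf (q * q)
  -- a positive `ε` with `5 ε` below all gaps of `V`
  obtain ⟨ε, hε, hgap⟩ : ∃ ε : ℝ, 0 < ε ∧ ∀ v ∈ V, ∀ v' ∈ V, v ≠ v' → 5 * ε ≤ |v - v'| := by
    rcases V.offDiag.eq_empty_or_nonempty with he | hne
    · refine ⟨1, one_pos, fun v hv v' hv' hne => ?_⟩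
      have : (v, v') ∈ V.offDiag := Finset.mem_offDiag.2 ⟨hv, hv', hne⟩
      simp [he] at this
    · obtain ⟨p, hp, hmin⟩ := V.offDiag.exists_min_image (fun p => |p.1 - p.2|) hne
      have hp' := Finset.mem_offDiag.1 hp
      have : 0 < |p.1 - p.2| := abs_pos.2 (sub_ne_zero.2 hp'.2.2)
      refine ⟨|p.1 - p.2| / 5, by positivity, fun v hv v' hv' hne => ?_⟩
      have := hmin (v, v') (Finset.mem_offDiag.2 ⟨hv, hv', hne⟩)
      simp only at this
      linarith
  have hT : ∀ v ∈ V, ∃ T : ℝ, 0 < T ∧ ∀ t, T ≤ t →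
      ∃ d ∈ allDistances S ∩ Set.Icc (t - k) (t + k),
      ∃ d' ∈ allDistances S ∩ Set.Icc (t - k) (t + k), |d' - d - v| ≤ 2 * ε := by
    intro v hv
    obtain ⟨f, ⟨u, hu, hf⟩, rfl⟩ := hV hv
    obtain ⟨T, hT0, hT⟩ := norm_asymptotics hf k hε
    refine ⟨T, hT0, fun t ht => ?_⟩
    obtain ⟨c, hc, hcK⟩ := hK (a + t • u)
    set h := c - a - t • u with hh
    have hhK : ‖h‖ ≤ K := by
      have : h = -(a + t • u - c) := by rw [hh]; abel
      rwa [this, norm_neg]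
    have hhw : ‖h + w‖ ≤ k := (norm_add_le _ _).trans (by linarith)
    have e1 : c - a = t • u + h := by rw [hh]; abel
    have e2 : c - a' = t • u + (h + w) := by rw [hh, hw]; abel
    have b1 := hT t ht h (by linarith [norm_nonneg w])
    have b2 := hT t ht (h + w) hhw
    have ht0 : 0 < t := hT0.trans_le ht
    have ntu : ‖t • u‖ = t := by rw [norm_smul, hu, Real.norm_of_nonneg ht0.le, mul_one]
    have hwin : ∀ g : X, ‖g‖ ≤ k → ‖t • u + g‖ ∈ Set.Icc (t - k) (t + k) := by
      intro g hg
      have h1 := norm_add_le (t • u) g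
      have h2 := norm_sub_le (t • u + g) g
      rw [add_sub_cancel_right] at h2
      constructor <;> linarith
    refine ⟨‖c - a‖, ⟨⟨c, hc, a, ha, rfl⟩, e1 ▸ hwin h (by linarith [norm_nonneg w])⟩, ‖c - a'‖,
      ⟨⟨c, hc, a', ha', rfl⟩, e2 ▸ hwin _ hhw⟩, ?_⟩
    rw [e1, e2]
    rw [map_add] at b2
    rw [abs_le] at *
    constructor <;> linarith [b1.1, b1.2, b2.1, b2.2]
  choose! T hT0 hT using hT
  have hbound := hD.window_le hC (k := k) (T := ∑ v ∈ V, T v) (q := q)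
    (by positivity) (Finset.sum_nonneg fun v hv => (hT0 v hv).le) (by
      intro t ht
      have hfin : (allDistances S ∩ Set.Icc (t - k) (t + k)).Finite :=
        (hD.finite (t + k)).subset (Set.inter_subset_inter_right _ fun x hx => hx.2)
      have hTv : ∀ v ∈ V, T v ≤ t := fun v hv =>
        (Finset.single_le_sum (f := T) (fun v hv => (hT0 v hv).le) hv).trans ht
      choose! d hd d' hd' hdd using fun v hv => hT v hv t (hTv v hv)
      have hinj : V.card ≤ (hfin.toFinset ×ˢ hfin.toFinset).card := by
        refine Finset.card_le_card_of_injOn (fun v => (d v, d' v)) (fun v hv => ?_) ?_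
        · simp only [Finset.coe_product, Set.mem_prod, Finset.mem_coe, Set.Finite.mem_toFinset]
          exact ⟨hd v hv, hd' v hv⟩
        · intro v hv v' hv' heq
          by_contra hne
          simp only [Prod.mk.injEq] at heq
          have h1 := hdd v hv
          have h2 := hdd v' hv'
          have h3 := hgap v hv v' hv' hne
          rw [heq.1, heq.2] at h1
          rw [abs_le] at h1 h2
          have : |v - v'| ≤ 4 * ε := abs_le.2 ⟨by linarith [h1.1, h1.2, h2.1, h2.2],
            by linarith [h1.1, h1.2, h2.1, h2.2]⟩
          linarith
      rw [hVcard, Finset.card_product, ← Set.ncard_eq_toFinset_card _ hfin] at hinj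
      exact Nat.mul_self_le_mul_self_iff.1 hinj)
  linarith

/-- A linear functional constant on a well-distributed set vanishes. -/
theorem span_sub_eq_top [FiniteDimensional ℝ X] {S : Set X} {K : ℝ}
    (hK : ∀ x : X, ∃ y ∈ S, ‖x - y‖ ≤ K) :
    Submodule.span ℝ {w : X | ∃ a ∈ S, ∃ a' ∈ S, w = a - a'} = ⊤ := by
  by_contra hne
  obtain ⟨f, hf0, hf⟩ := Submodule.exists_le_ker_of_lt_top _ (lt_top_iff_ne_top.2 hne)
  apply hf0
  set g : X →L[ℝ] ℝ := f.toContinuousLinearMap with hg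
  obtain ⟨s, hs, -⟩ := hK 0
  have hb : ∀ x, |f x| ≤ |f s| + ‖g‖ * K := by
    intro x
    obtain ⟨y, hy, hxy⟩ := hK x
    have h1 : f (y - s) = 0 := hf (Submodule.subset_span ⟨y, hy, s, hs, rfl⟩)
    have h2 : |f (x - y)| ≤ ‖g‖ * K := (g.le_opNorm (x - y)).trans (by gcongr)
    have h3 : f x = f (x - y) + f s := by
      rw [map_sub] at *; linarith
    rw [h3]
    exact (abs_add_le _ _).trans (by linarith)
  ext x
  by_contra hx
  have hx' : 0 < |f x| := abs_pos.2 hx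
  obtain ⟨n, hn⟩ := exists_nat_gt ((|f s| + ‖g‖ * K) / |f x|)
  rw [div_lt_iff₀ hx'] at hn
  have := hb ((n : ℝ) • x)
  rw [map_smul, smul_eq_mul, abs_mul, Nat.abs_cast] at this
  linarith

theorem finite_normDerivatives [FiniteDimensional ℝ X] {S : Set X} {K C : ℝ}
    (hK : ∀ x : X, ∃ y ∈ S, ‖x - y‖ ≤ K) (hC : 0 ≤ C) (hD : LinearGrowth (allDistances S) C) :
    (normDerivatives X).Finite := by
  set b := Module.Basis.ofSpan (span_sub_eq_top hK).ge
  have hb : ∀ i, b i ∈ {w : X | ∃ a ∈ S, ∃ a' ∈ S, w = a - a'} := fun i =>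
    Module.Basis.ofSpan_subset (span_sub_eq_top hK).ge ⟨i, rfl⟩
  have : Finite (((linearIndepOn_empty ℝ id).extend (Set.empty_subset
    {w : X | ∃ a ∈ S, ∃ a' ∈ S, w = a - a'}))) := Module.Finite.finite_basis b
  have hpi : (Set.univ.pi fun i => (fun f : X →L[ℝ] ℝ => f (b i)) '' normDerivatives X).Finite := by
    refine Set.Finite.pi fun i => ?_
    obtain ⟨a, ha, a', ha', hw⟩ := hb i
    rw [hw]
    exact finite_image_normDerivatives hK hC hD ha ha'
  refine Set.Finite.of_finite_image (f := fun (f : X →L[ℝ] ℝ) i => f (b i))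
    (hpi.subset ?_) ?_
  · rintro _ ⟨f, hf, rfl⟩ i -
    exact ⟨f, hf, rfl⟩
  · intro f _ g _ hfg
    have : (f : X →ₗ[ℝ] ℝ) = g := b.ext fun i => congrFun hfg i
    exact ContinuousLinearMap.coe_injective this

/-- `L` is a finite set of functionals whose maximum is the norm. -/
structure IsNormingSet (L : Set (X →L[ℝ] ℝ)) : Prop where
  finite : L.Finite
  le_norm : ∀ f ∈ L, ∀ x, f x ≤ ‖x‖
  exists_eq : ∀ x, ∃ f ∈ L, f x = ‖x‖

/-- A finite family of functionals that attains the norm on a dense set is norming. -/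
theorem IsNormingSet.of_dense {L : Set (X →L[ℝ] ℝ)} (hfin : L.Finite)
    (hle : ∀ f ∈ L, ∀ x, f x ≤ ‖x‖) (hd : Dense {x : X | ∃ f ∈ L, f x = ‖x‖}) :
    IsNormingSet L := by
  refine ⟨hfin, hle, fun x => ?_⟩
  have hcl : IsClosed {x : X | ∃ f ∈ L, f x = ‖x‖} := by
    have : {x : X | ∃ f ∈ L, f x = ‖x‖} = ⋃ f ∈ L, {x | f x = ‖x‖} := by ext; simp
    rw [this]
    exact hfin.isClosed_biUnion fun f _ => isClosed_eq f.continuous continuous_norm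
  have := hd.closure_eq ▸ hcl.closure_eq
  exact (this ▸ Set.mem_univ x : x ∈ {x : X | ∃ f ∈ L, f x = ‖x‖})

theorem isNormingSet_normDerivatives [FiniteDimensional ℝ X] [Nontrivial X]
    (hfin : (normDerivatives X).Finite) : IsNormingSet (normDerivatives X) := by
  refine .of_dense hfin ?_ ?_
  · rintro f ⟨u, hu, hf⟩ x
    have h1 : ‖f‖ ≤ 1 := by simpa using hf.le_of_lipschitz lipschitzWith_one_norm
    exact (le_abs_self _).trans ((f.le_opNorm x).trans (by nlinarith [norm_nonneg x]))
  · borelize X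
    have hae := (lipschitzWith_one_norm (E := X)).ae_differentiableAt
      (μ := MeasureTheory.Measure.addHaar)
    refine (MeasureTheory.Measure.dense_of_ae hae).mono fun x hx => ?_
    have hx0 : x ≠ 0 := by
      rintro rfl
      exact not_differentiableAt_norm_zero X hx
    have hpos : 0 < ‖x‖ := norm_pos_iff.2 hx0
    refine ⟨fderiv ℝ (fun x : X => ‖x‖) x, ⟨‖x‖⁻¹ • x, ?_, ?_⟩, hx.fderiv_norm_self⟩
    · rw [norm_smul, norm_inv, norm_norm, inv_mul_cancel₀ hpos.ne']
    · exact hx.hasFDerivAt.hasFDerivAt_norm_smul_pos (inv_pos.2 hpos)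

theorem IsNormingSet.isFinitePolygon [FiniteDimensional ℝ X] {L : Set (X →L[ℝ] ℝ)}
    (hL : IsNormingSet L) : IsFinitePolygon (Metric.closedBall (0 : X) 1) := by
  have hball : ∀ x : X, x ∈ Metric.closedBall (0 : X) 1 ↔ ∀ f ∈ L, f x ≤ 1 := by
    intro x
    rw [mem_closedBall_zero_iff]
    refine ⟨fun h f hf => (hL.le_norm f hf x).trans h, fun h => ?_⟩
    obtain ⟨f, hf, hfx⟩ := hL.exists_eq x
    exact hfx ▸ h f hf
  have hint : (interior (Metric.closedBall (0 : X) 1)).Nonempty :=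
    ⟨0, Metric.ball_subset_interior_closedBall (Metric.mem_ball_self one_pos)⟩
  have hext : (Set.extremePoints ℝ (Metric.closedBall (0 : X) 1)).Finite := by
    -- an extreme point is determined by the functionals attaining the value `1` there
    refine Set.Finite.of_finite_image (f := fun x => {f ∈ L | f x = 1})
      (hL.finite.finite_subsets.subset ?_) ?_
    · rintro _ ⟨x, -, rfl⟩
      exact Set.sep_subset _ _
    · intro x hx y hy hxy
      by_contra hne
      simp only at hxy
      have hxb := (hball x).1 hx.1
      have hev : ∀ᶠ s : ℝ in 𝓝 0, ∀ f ∈ L, f (x + s • (y - x)) ≤ 1 := by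
        rw [hL.finite.eventually_all]
        intro f hf
        by_cases h1 : f x = 1
        · have h2 : f y = 1 := (hxy ▸ ⟨hf, h1⟩ : f ∈ {f ∈ L | f y = 1}).2
          refine Eventually.of_forall fun s => ?_
          simp [h1, h2]
        · have hlt : f x < 1 := lt_of_le_of_ne (hxb f hf) h1
          have hc : Continuous fun s : ℝ => f (x + s • (y - x)) := by fun_prop
          have := hc.tendsto 0
          simp only [zero_smul, add_zero] at this
          exact (this.eventually_lt_const hlt).mono fun s hs => hs.le
      obtain ⟨δ, hδ, hs⟩ := Metric.eventually_nhds_iff.1 hev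
      have hp := (hball _).2 (hs (y := δ / 2) (by simp [abs_of_pos hδ]; linarith))
      have hm := (hball _).2 (hs (y := -(δ / 2)) (by simp [abs_of_pos hδ]; linarith))
      have hmem : x ∈ openSegment ℝ (x + (δ / 2) • (y - x)) (x + (-(δ / 2)) • (y - x)) :=
        ⟨1 / 2, 1 / 2, by norm_num, by norm_num, by norm_num, by module⟩
      have := hx.2 hp hm hmem
      have h0 : (δ / 2) • (y - x) = 0 := by simpa using this
      rcases smul_eq_zero.1 h0 with h | h
      · linarith
      · exact hne (sub_eq_zero.1 h).symm
  refine ⟨⟨_, hext, ?_⟩, hint⟩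
  have := closure_convexHull_extremePoints (isCompact_closedBall (0 : X) 1)
    (convex_closedBall (0 : X) 1)
  rw [(hext.isClosed_convexHull ℝ).closure_eq] at this
  exact this.symm
end

/-! ### Local finiteness of differences -/

section
variable {X : Type*} [NormedAddCommGroup X] [NormedSpace ℝ X]

/-- `f` agrees with the norm on a cone around the unit vector `u`, of aperture given by `ρ`. -/
structure IsNormOnCone (f : X →L[ℝ] ℝ) (u : X) (ρ : ℝ) : Prop where
  pos : 0 < ρ
  norm_eq : ‖u‖ = 1
  apply_eq : f u = 1
  abs_le : ∀ x, |f x| ≤ ‖x‖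
  norm_add_eq : ∀ t : ℝ, 0 < t → ∀ h : X, ‖h‖ ≤ ρ * t → ‖t • u + h‖ = f (t • u + h)

theorem IsNormingSet.abs_le {L : Set (X →L[ℝ] ℝ)} (hL : IsNormingSet L) {f : X →L[ℝ] ℝ}
    (hf : f ∈ L) (x : X) : |f x| ≤ ‖x‖ := by
  refine _root_.abs_le.2 ⟨?_, hL.le_norm f hf x⟩
  have := hL.le_norm f hf (-x)
  rw [map_neg, norm_neg] at this
  linarith

/-- At a smooth point `u` only the derivative of the norm can attain the norm, so it still does so
near `u`. -/
theorem IsNormingSet.exists_isNormOnCone {L : Set (X →L[ℝ] ℝ)} (hL : IsNormingSet L)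
    {f : X →L[ℝ] ℝ} (hfL : f ∈ L) (hf : f ∈ normDerivatives X) :
    ∃ u ρ, IsNormOnCone f u ρ := by
  obtain ⟨u, hu, hfu⟩ := hf
  have huniq : ∀ g ∈ L, g u = ‖u‖ → g = f := by
    intro g hg hgu
    have hmax : IsLocalMax (fun x : X => g x - ‖x‖) u := by
      refine Eventually.of_forall fun x => ?_
      have := hL.le_norm g hg x
      simp only [hgu, sub_self]
      linarith
    exact sub_eq_zero.1 (hmax.hasFDerivAt_eq_zero (g.hasFDerivAt.sub hfu))
  have hev : ∀ᶠ x in 𝓝 u, ∀ g ∈ L, g ≠ f → g x < ‖x‖ := by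
    rw [hL.finite.eventually_all]
    intro g hg
    by_cases hgf : g = f
    · exact Eventually.of_forall fun x h => absurd hgf h
    · have hlt : g u < ‖u‖ := lt_of_le_of_ne (hL.le_norm g hg u) fun h => hgf (huniq g hg h)
      filter_upwards [g.continuous.continuousAt.eventually_lt continuous_norm.continuousAt hlt]
        with x hx _ using hx
  have heq : ∀ x, (∀ g ∈ L, g ≠ f → g x < ‖x‖) → ‖x‖ = f x := by
    intro x hx
    obtain ⟨g, hg, hgx⟩ := hL.exists_eq x
    by_cases hgf : g = f
    · rw [← hgx, hgf]
    · exact absurd hgx (hx g hg hgf).ne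
  obtain ⟨δ, hδ, hball⟩ := Metric.eventually_nhds_iff.1 hev
  refine ⟨u, δ / 2, by positivity, hu, ?_, hL.abs_le hfL, fun t ht h hh => ?_⟩
  · rw [← heq u (hball (by simpa using hδ)), hu]
  · have h1 : ‖t⁻¹ • h‖ ≤ δ / 2 := by
      rw [norm_smul, norm_inv, Real.norm_of_nonneg ht.le, inv_mul_le_iff₀ ht]
      linarith
    have h2 := heq (u + t⁻¹ • h) (hball (by rw [dist_eq_norm, add_sub_cancel_left]; linarith))
    have e1 : t • u + h = t • (u + t⁻¹ • h) := by
      rw [smul_add, smul_smul, mul_inv_cancel₀ ht.ne', one_smul]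
    rw [e1, norm_smul, h2, Real.norm_of_nonneg ht.le, map_smul, smul_eq_mul]

open scoped Pointwise in
/-- Plünnecke's inequality bounds `A + A - A` in terms of `B - A`; the sums of an element of `E` and
an element of `A₀` are distinct elements of it. -/
theorem card_mul_card_le_of_sub {A B A₀ E : Finset ℝ} (hB : B.Nonempty)
    (hA₀ : A₀ ⊆ A) (hE : E ⊆ A - A)
    (hinj : Set.InjOn (fun p : ℝ × ℝ => p.1 + p.2) (E ×ˢ A₀ : Finset (ℝ × ℝ))) :
    E.card * A₀.card * B.card ^ 2 ≤ (B - A).card ^ 3 := by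
  have h1 : E + A₀ ⊆ 2 • A - 1 • A := by
    rw [two_nsmul, one_nsmul]
    calc E + A₀ ⊆ (A - A) + A := Finset.add_subset_add hE hA₀
      _ = A + A - A := by rw [sub_add_eq_add_sub]
  have h2 : (E + A₀).card = E.card * A₀.card := by
    exact Finset.card_add_iff.2 (by simpa using hinj)
  have h3 := Finset.pluennecke_ruzsa_inequality_nsmul_sub_nsmul_sub hB A 2 1
  have hBpos : (0 : ℚ) < (B.card : ℚ) := Nat.cast_pos.2 hB.card_pos
  have h4 : ((E.card * A₀.card : ℕ) : ℚ) ≤ ((B - A).card / B.card : ℚ) ^ 3 * B.card := by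
    have := (Nat.cast_le (α := ℚ≥0)).2 (Finset.card_le_card h1)
    rw [h2] at this
    exact_mod_cast this.trans h3
  have h5 : ((B - A).card / B.card : ℚ) ^ 3 * B.card * (B.card : ℚ) ^ 2 =
      ((B - A).card : ℚ) ^ 3 := by
    field_simp
  have h6 := mul_le_mul_of_nonneg_right h4 (sq_nonneg (B.card : ℚ))
  rw [h5] at h6
  exact_mod_cast h6

open scoped Pointwise in
/-- If `f` agrees with the norm on a cone, then the differences of values of `f` on a
well-distributed set with linearly many distances form a locally finite set. -/
theorem IsNormOnCone.finite_differences {f : X →L[ℝ] ℝ} {u : X} {ρ : ℝ}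
    (hf : IsNormOnCone f u ρ) {S : Set X} {K C : ℝ} (hK : ∀ x : X, ∃ y ∈ S, ‖x - y‖ ≤ K)
    (hC : 0 ≤ C) (hD : LinearGrowth (allDistances S) C) (R : ℝ) :
    {v : ℝ | |v| ≤ R ∧ ∃ a ∈ S, ∃ b ∈ S, v = f a - f b}.Finite := by
  classical
  by_contra hinf
  have hρ := hf.pos
  have hK0 : 0 ≤ K := by
    obtain ⟨y, -, hy⟩ := hK 0
    exact (norm_nonneg _).trans hy
  obtain ⟨s, hs⟩ : ∃ s : ℝ, s = 2 * |R| + 1 + 2 * K := ⟨_, rfl⟩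
  have hs1 : 1 ≤ s := by linarith [abs_nonneg R]
  obtain ⟨M, hM⟩ : ∃ M : ℝ, M = 2 / ρ := ⟨_, rfl⟩
  have hM0 : 0 < M := hM ▸ by positivity
  obtain ⟨H, hH⟩ : ∃ H : ℝ, H = C * (M + 4) * s * 2 := ⟨_, rfl⟩
  have hH0 : 0 ≤ H := hH ▸ by positivity
  obtain ⟨q, hq⟩ := exists_nat_gt (H ^ 3)
  obtain ⟨E, hE, hEcard⟩ := Set.Infinite.exists_subset_card_eq hinf q
  -- the point of `S` near `t • u`
  choose p hpS hpK using fun t : ℝ => hK (t • u)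
  have hfp : ∀ t, |f (p t) - t| ≤ K := by
    intro t
    have h1 := (hf.abs_le (t • u - p t)).trans (hpK t)
    rwa [map_sub, map_smul, hf.apply_eq, smul_eq_mul, mul_one, abs_sub_comm] at h1
  have hsep : ∀ t t', s ≤ |t - t'| → 2 * |R| + 1 ≤ |f (p t) - f (p t')| := by
    intro t t' h
    have h1 : t - t' = (f (p t) - f (p t')) - (f (p t) - t) + (f (p t') - t') := by ring
    have h2 := abs_add_le ((f (p t) - f (p t')) - (f (p t) - t)) (f (p t') - t')
    have h3 := abs_sub (f (p t) - f (p t')) (f (p t) - t)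
    rw [← h1] at h2
    linarith [hfp t, hfp t']
  have hsep' : ∀ (r : ℝ) (j j' : ℕ), j ≠ j' →
      2 * |R| + 1 ≤ |f (p (r + s * j)) - f (p (r + s * j'))| := by
    intro r j j' hne
    refine hsep _ _ ?_
    have h1 : (1 : ℝ) ≤ |(j : ℝ) - j'| := by
      have : (1 : ℤ) ≤ |(j : ℤ) - j'| := Int.one_le_abs (sub_ne_zero.2 (by exact_mod_cast hne))
      exact_mod_cast this
    rw [show r + s * j - (r + s * j') = s * ((j : ℝ) - j') by ring, abs_mul,
      abs_of_nonneg (by linarith : 0 ≤ s)]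
    nlinarith
  -- a ball containing points of `S` that represent the elements of `E`
  obtain ⟨T₀, hT₀⟩ : ∃ T₀ : ℝ, ∀ v ∈ E, ∃ a ∈ S, ∃ b ∈ S, ‖a‖ ≤ T₀ ∧ ‖b‖ ≤ T₀ ∧ v = f a - f b := by
    choose! a ha b hb hab using fun (v : ℝ) (hv : v ∈ E) => (hE hv).2
    refine ⟨∑ v ∈ E, (‖a v‖ + ‖b v‖), fun v hv => ⟨a v, ha v hv, b v, hb v hv, ?_⟩⟩
    have := Finset.single_le_sum (f := fun v => ‖a v‖ + ‖b v‖) (fun v _ => by positivity) hv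
    exact ⟨by linarith [norm_nonneg (b v)], by linarith [norm_nonneg (a v)], hab v hv⟩
  obtain ⟨J, hJ⟩ := exists_nat_gt (max T₀ 1)
  have hJ1 : (1 : ℝ) < J := (le_max_right _ _).trans_lt hJ
  have hJT : T₀ < J := (le_max_left _ _).trans_lt hJ
  obtain ⟨T, hT⟩ : ∃ T : ℝ, T = s * (J + 1) := ⟨_, rfl⟩
  have hT1 : 1 ≤ T := by nlinarith
  have hT₀T : T₀ ≤ T := by nlinarith
  set As : Set ℝ := f '' (S ∩ Metric.closedBall 0 T) with hAs
  set Bs : Set ℝ := f '' (S ∩ Metric.closedBall ((M * T) • u) T) with hBs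
  have hpmem : ∀ (r : ℝ) (j : ℕ), j < J →
      f (p (r + s * j)) ∈ f '' (S ∩ Metric.closedBall (r • u) T) := by
    intro r j hj
    refine ⟨_, ⟨hpS _, ?_⟩, rfl⟩
    rw [mem_closedBall_iff_norm]
    have hj' : (j : ℝ) + 1 ≤ J := by exact_mod_cast hj
    have e : p (r + s * j) - r • u = (s * j) • u - ((r + s * j) • u - p (r + s * j)) := by
      rw [add_smul]; abel
    rw [e]
    refine (norm_sub_le _ _).trans ?_
    have h1 : ‖(s * (j : ℝ)) • u‖ = s * j := by
      rw [norm_smul, hf.norm_eq, Real.norm_of_nonneg (by positivity), mul_one]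
    rw [h1]
    have := hpK (r + s * j)
    nlinarith [abs_nonneg R]
  have hJ0 : 0 < J := by
    have : (0 : ℝ) < J := by linarith
    exact_mod_cast this
  have hA0 : f (p (0 + s * (0 : ℕ))) ∈ As := by simpa [hAs] using hpmem 0 0 hJ0
  have hB0 : f (p (M * T + s * (0 : ℕ))) ∈ Bs := hpmem (M * T) 0 hJ0
  have hsub : ∀ x ∈ Bs, ∀ y ∈ As, x - y ∈ allDistances S ∩ Set.Iic ((M + 2) * T) := by
    rintro _ ⟨c, ⟨hcS, hc⟩, rfl⟩ _ ⟨a, ⟨haS, ha⟩, rfl⟩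
    rw [mem_closedBall_iff_norm] at hc ha
    rw [sub_zero] at ha
    set h := c - (M * T) • u - a with hh
    have hh2 : ‖h‖ ≤ 2 * T := (norm_sub_le _ _).trans (by linarith)
    have e : c - a = (M * T) • u + h := by rw [hh]; abel
    have h1 := hf.norm_add_eq (M * T) (by positivity) h (by
      rw [hM]
      calc ‖h‖ ≤ 2 * T := hh2
        _ = ρ * (2 / ρ * T) := by field_simp)
    rw [← e, map_sub] at h1
    refine ⟨⟨c, hcS, a, haS, h1.symm⟩, ?_⟩
    rw [Set.mem_Iic, ← h1, e]
    refine (norm_add_le _ _).trans ?_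
    rw [norm_smul, hf.norm_eq, Real.norm_of_nonneg (by positivity)]
    linarith
  have hDfin := hD.finite ((M + 2) * T)
  have hAfin : As.Finite := by
    refine (hDfin.image fun d => f (p (M * T + s * (0 : ℕ))) - d).subset fun y hy => ?_
    exact ⟨_, hsub _ hB0 y hy, by ring⟩
  have hBfin : Bs.Finite := by
    refine (hDfin.image fun d => d + f (p (0 + s * (0 : ℕ)))).subset fun x hx => ?_
    exact ⟨_, hsub x hx _ hA0, by ring⟩
  let A := hAfin.toFinset
  let B := hBfin.toFinset
  set A₀ : Finset ℝ := (Finset.range J).image fun j : ℕ => f (p (0 + s * j)) with hA₀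
  have hinjA : ∀ r : ℝ, Set.InjOn (fun j : ℕ => f (p (r + s * j))) (Finset.range J) := by
    intro r j _ j' _ h
    by_contra hne
    have := hsep' r j j' hne
    simp only at h
    rw [h, sub_self, abs_zero] at this
    linarith [abs_nonneg R]
  have hA₀card : A₀.card = J := by
    rw [hA₀, Finset.card_image_of_injOn (hinjA 0), Finset.card_range]
  have hBcard : J ≤ B.card := by
    have : ((Finset.range J).image fun j : ℕ => f (p (M * T + s * j))) ⊆ B := by
      intro x hx
      obtain ⟨j, hj, rfl⟩ := Finset.mem_image.1 hx
      exact hBfin.mem_toFinset.2 (hpmem _ j (Finset.mem_range.1 hj))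
    have h1 := Finset.card_le_card this
    rwa [Finset.card_image_of_injOn (hinjA _), Finset.card_range] at h1
  have hBA : ((B - A).card : ℝ) ≤ H * J := by
    have h1 : ((B - A : Finset ℝ) : Set ℝ) ⊆ allDistances S ∩ Set.Iic ((M + 2) * T) := by
      intro z hz
      obtain ⟨x, hx, y, hy, rfl⟩ := Finset.mem_sub.1 (Finset.mem_coe.1 hz)
      exact hsub x (hBfin.mem_toFinset.1 hx) y (hAfin.mem_toFinset.1 hy)
    have h2 := Set.ncard_le_ncard h1 hDfin
    rw [Set.ncard_coe_finset] at h2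
    have h3 := hD.ncard_le hC (x := (M + 2) * T) (by positivity)
    have h4 : ((B - A).card : ℝ) ≤ C * ((M + 2) * T + 2) := (Nat.cast_le.2 h2).trans h3
    refine h4.trans ?_
    calc C * ((M + 2) * T + 2) ≤ C * ((M + 4) * T) := by gcongr; linarith
      _ = C * (M + 4) * s * (J + 1) := by rw [hT]; ring
      _ ≤ C * (M + 4) * s * (2 * J) := by gcongr; linarith
      _ = H * J := by rw [hH]; ring
  have hmain := card_mul_card_le_of_sub (A := A) (B := B) (A₀ := A₀) (E := E)
    ⟨_, hBfin.mem_toFinset.2 hB0⟩ (by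
      intro x hx
      obtain ⟨j, hj, rfl⟩ := Finset.mem_image.1 hx
      have := hpmem 0 j (Finset.mem_range.1 hj)
      rw [zero_smul] at this
      exact hAfin.mem_toFinset.2 this) (by
      intro v hv
      obtain ⟨a, ha, b, hb, ha', hb', rfl⟩ := hT₀ v hv
      refine Finset.sub_mem_sub (hAfin.mem_toFinset.2 ⟨a, ⟨ha, ?_⟩, rfl⟩)
        (hAfin.mem_toFinset.2 ⟨b, ⟨hb, ?_⟩, rfl⟩)
      · rw [mem_closedBall_zero_iff]; linarith
      · rw [mem_closedBall_zero_iff]; linarith) (by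
      rintro ⟨e, x⟩ hex ⟨e', x'⟩ hex' heq
      simp only [Finset.coe_product, Set.mem_prod, Finset.mem_coe] at hex hex' heq
      obtain ⟨j, -, rfl⟩ := Finset.mem_image.1 hex.2
      obtain ⟨j', -, rfl⟩ := Finset.mem_image.1 hex'.2
      have hjj : j = j' := by
        by_contra hne
        have h1 := hsep' 0 j j' hne
        have h2 : f (p (0 + s * j)) - f (p (0 + s * j')) = e' - e := by linarith
        rw [h2] at h1
        have h3 := abs_sub e' e
        linarith [(hE hex.1).1, (hE hex'.1).1, le_abs_self R]
      subst hjj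
      simpa using heq)
  rw [hEcard, hA₀card] at hmain
  have h1 : (q : ℝ) * J ^ 3 ≤ H ^ 3 * J ^ 3 := by
    calc (q : ℝ) * J ^ 3 = ((q * J * J ^ 2 : ℕ) : ℝ) := by push_cast; ring
      _ ≤ ((q * J * B.card ^ 2 : ℕ) : ℝ) := by
        exact Nat.cast_le.2 (Nat.mul_le_mul_left _ (Nat.pow_le_pow_left hBcard 2))
      _ ≤ (((B - A).card ^ 3 : ℕ) : ℝ) := Nat.cast_le.2 hmain
      _ = ((B - A).card : ℝ) ^ 3 := by push_cast; ring
      _ ≤ (H * J) ^ 3 := by gcongr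
      _ = H ^ 3 * J ^ 3 := by ring
  exact absurd (le_of_mul_le_mul_right h1 (by positivity)) (not_le.2 hq)
end

/-! ### Algebraicity from almost dilations -/

/-- Let `a : ℝ → ℝ` be at bounded distance from the identity, with finitely many values of
`a t - a s` for `|t - s| ≤ 1`. If `a` commutes with the multiplication by `μ` up to a finite set of
errors, then `μ` is algebraic: two far apart points with the same first errors have a difference `x`
such that all `μ ^ j * x` lie in a fixed finitely generated group. -/
theorem isAlgebraic_of_almost_dilation {a : ℝ → ℝ} {K μ : ℝ} (hK : ∀ t, |a t - t| ≤ K)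
    (hloc : {v : ℝ | ∃ t s : ℝ, |t - s| ≤ 1 ∧ v = a t - a s}.Finite)
    (hμ : (Set.range fun t => μ * a t - a (μ * t)).Finite) : IsAlgebraic ℚ μ := by
  set V : Submodule ℚ ℝ := Submodule.span ℚ {v : ℝ | ∃ t s : ℝ, |t - s| ≤ 1 ∧ v = a t - a s}
    with hV
  have : FiniteDimensional ℚ V := FiniteDimensional.span_of_finite ℚ hloc
  have hVloc : ∀ t s : ℝ, |t - s| ≤ 1 → a t - a s ∈ V := fun t s h =>
    Submodule.subset_span ⟨t, s, h, rfl⟩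
  have hVint : ∀ n : ℤ, a n - a 0 ∈ V := by
    intro n
    induction n using Int.induction_on with
    | zero => simp
    | succ n ih =>
      have := V.add_mem (hVloc ((n : ℤ) + 1 : ℤ) (n : ℤ) (by simp)) ih
      simpa using this
    | pred n ih =>
      have := V.add_mem (hVloc (-(n : ℤ) - 1 : ℤ) (-(n : ℤ) : ℤ) (by simp [sub_eq_add_neg])) ih
      simpa using this
  have hV0 : ∀ t : ℝ, a t - a 0 ∈ V := by
    intro t
    have := V.add_mem (hVloc t ⌊t⌋ (by
      rw [abs_of_nonneg (by linarith [Int.floor_le t])]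
      linarith [Int.lt_floor_add_one t])) (hVint ⌊t⌋)
    simpa using this
  have hVall : ∀ t s : ℝ, a t - a s ∈ V := fun t s => by
    simpa using V.sub_mem (hV0 t) (hV0 s)
  set n := Module.finrank ℚ V
  have := hμ.to_subtype
  obtain ⟨m, m', hne, heq⟩ := Finite.exists_ne_map_eq_of_infinite
    (fun (m : ℕ) (j : Fin (n + 1)) =>
      (⟨_, Set.mem_range_self (μ ^ (j : ℕ) * ((2 * K + 1) * m))⟩ :
        Set.range fun t => μ * a t - a (μ * t)))
  set t := (2 * K + 1) * (m : ℝ) with ht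
  set t' := (2 * K + 1) * (m' : ℝ) with ht'
  have hpow : ∀ j : ℕ, j ≤ n → μ ^ j * (a t - a t') = a (μ ^ j * t) - a (μ ^ j * t') := by
    intro j
    induction j with
    | zero => simp
    | succ j ih =>
      intro hj
      have h1 := ih (by omega)
      have h2 := congrArg Subtype.val (congrFun heq ⟨j, by omega⟩)
      simp only at h2
      rw [pow_succ', mul_assoc, h1, mul_assoc, mul_assoc]
      linarith
  have hx : a t - a t' ≠ 0 := by
    intro h0
    have hK0 : 0 ≤ K := (abs_nonneg _).trans (hK 0)
    have h1 : (1 : ℝ) ≤ |(m : ℝ) - m'| := by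
      have : (1 : ℤ) ≤ |(m : ℤ) - m'| := Int.one_le_abs (sub_ne_zero.2 (by exact_mod_cast hne))
      exact_mod_cast this
    have h2 : |t - t'| = (2 * K + 1) * |(m : ℝ) - m'| := by
      rw [ht, ht', ← mul_sub, abs_mul, abs_of_nonneg (by linarith : 0 ≤ 2 * K + 1)]
    have h3 : |t - t'| ≤ |a t' - t'| + |a t - t| := by
      have : t - t' = (a t' - t') - (a t - t) := by linarith
      rw [this]
      exact abs_sub _ _
    nlinarith [hK t, hK t']
  have hmem : ∀ j : Fin (n + 1), μ ^ (j : ℕ) * (a t - a t') ∈ V := fun j => by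
    rw [hpow j (by omega)]
    exact hVall _ _
  have hdep : ¬ LinearIndependent ℚ fun j : Fin (n + 1) =>
      (⟨μ ^ (j : ℕ) * (a t - a t'), hmem j⟩ : V) := by
    intro h
    have := h.fintype_card_le_finrank
    simp [n] at this
  obtain ⟨g, hg, i, hi⟩ := Fintype.not_linearIndependent_iff.1 hdep
  refine ⟨∑ j : Fin (n + 1), Polynomial.monomial (j : ℕ) (g j), fun h0 => hi ?_, ?_⟩
  · have := congrArg (fun p => Polynomial.coeff p (i : ℕ)) h0
    simpa [Polynomial.finsetSum_coeff, Polynomial.coeff_monomial, Fin.val_inj] using this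
  · have h1 := congrArg Subtype.val hg
    simp only [Submodule.coe_sum, Submodule.coe_smul, ZeroMemClass.coe_zero] at h1
    refine (mul_eq_zero.1 ?_).resolve_right hx
    rw [map_sum, Finset.sum_mul, ← h1]
    refine Finset.sum_congr rfl fun j _ => ?_
    rw [Polynomial.aeval_monomial, Algebra.smul_def, mul_assoc]

section
variable {X : Type*} [NormedAddCommGroup X] [NormedSpace ℝ X]

/-- Four functionals with locally finite differences on a well-distributed set have an algebraic
cross-ratio. -/
theorem isAlgebraic_of_finite_differences {S : Set X} {K : ℝ}
    (hK : ∀ x : X, ∃ y ∈ S, ‖x - y‖ ≤ K) {l₁ l₂ : X →L[ℝ] ℝ} {e₁ e₂ : X}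
    (h₁₁ : l₁ e₁ = 1) (h₁₂ : l₁ e₂ = 0) (h₂₁ : l₂ e₁ = 0) (h₂₂ : l₂ e₂ = 1)
    {α β γ δ : ℝ} (hα : α ≠ 0) (hβ : β ≠ 0) (hδ : δ ≠ 0)
    (hfin : ∀ f ∈ ({l₁, l₂, α • l₁ + β • l₂, γ • l₁ + δ • l₂} : Set (X →L[ℝ] ℝ)), ∀ R : ℝ,
      {v : ℝ | |v| ≤ R ∧ ∃ a ∈ S, ∃ b ∈ S, v = f a - f b}.Finite) :
    IsAlgebraic ℚ (γ * β / (α * δ)) := by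
  -- points of `S` near the two coordinate axes
  choose p hpS hpK using fun t : ℝ => hK (t • e₁)
  choose q hqS hqK using fun t : ℝ => hK (t • e₂)
  have near : ∀ (l : X →L[ℝ] ℝ) (x y : X), ‖x - y‖ ≤ K → |l y - l x| ≤ ‖l‖ * K := by
    intro l x y h
    rw [abs_sub_comm, ← map_sub]
    exact (l.le_opNorm _).trans (by gcongr)
  have hp : ∀ (l : X →L[ℝ] ℝ) (t : ℝ), |l (p t) - t * l e₁| ≤ ‖l‖ * K := fun l t => by
    simpa using near l _ _ (hpK t)
  have hq : ∀ (l : X →L[ℝ] ℝ) (t : ℝ), |l (q t) - t * l e₂| ≤ ‖l‖ * K := fun l t => by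
    simpa using near l _ _ (hqK t)
  have two : ∀ x y x' y' M M' : ℝ, |x - x'| ≤ M → |y - y'| ≤ M' → |x - y| ≤ M + M' + |x' - y'| := by
    intro x y x' y' M M' h h'
    have : x - y = (x - x') - (y - y') + (x' - y') := by ring
    rw [this]
    exact (abs_add_le _ _).trans (by linarith [abs_sub (x - x') (y - y')])
  -- the bounded coordinate takes finitely many values
  have hF₂ : (Set.range fun t => l₂ (p t) - l₂ (p 0)).Finite := by
    refine (hfin l₂ (by simp) (‖l₂‖ * K + ‖l₂‖ * K + 0)).subset ?_
    rintro _ ⟨t, rfl⟩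
    refine ⟨?_, _, hpS t, _, hpS 0, rfl⟩
    simpa [h₂₁] using two _ _ _ _ _ _ (hp l₂ t) (hp l₂ 0)
  have hF₁ : (Set.range fun t => l₁ (q t) - l₁ (q 0)).Finite := by
    refine (hfin l₁ (by simp) (‖l₁‖ * K + ‖l₁‖ * K + 0)).subset ?_
    rintro _ ⟨t, rfl⟩
    refine ⟨?_, _, hqS t, _, hqS 0, rfl⟩
    simpa [h₁₂] using two _ _ _ _ _ _ (hq l₁ t) (hq l₁ 0)
  -- the third and the fourth functional compare the two axes
  have hcmp : ∀ c d : ℝ, d ≠ 0 → (∀ R : ℝ,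
      {v : ℝ | |v| ≤ R ∧ ∃ a ∈ S, ∃ b ∈ S, v = (c • l₁ + d • l₂) a - (c • l₁ + d • l₂) b}.Finite) →
      (Set.range fun t => c * l₁ (p t) - d * l₂ (q (c * t / d))).Finite := by
    intro c d hd h
    set l := c • l₁ + d • l₂ with hl
    have h1 := h (‖l‖ * K + ‖l‖ * K + 0)
    refine ((h1.prod (hF₂.prod hF₁)).image fun z =>
      z.1 - d * (z.2.1 + l₂ (p 0)) + c * (z.2.2 + l₁ (q 0))).subset ?_
    rintro _ ⟨t, rfl⟩
    refine ⟨(l (p t) - l (q (c * t / d)), l₂ (p t) - l₂ (p 0),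
      l₁ (q (c * t / d)) - l₁ (q 0)), ⟨⟨?_, _, hpS _, _, hqS _, rfl⟩, ⟨t, rfl⟩, ⟨_, rfl⟩⟩, ?_⟩
    · have h2 := two _ _ _ _ _ _ (hp l t) (hq l (c * t / d))
      have h3 : t * l e₁ - c * t / d * l e₂ = 0 := by
        simp only [hl, add_apply, smul_apply, smul_eq_mul, h₁₁, h₁₂, h₂₁, h₂₂]
        field_simp
        ring
      rwa [h3, abs_zero] at h2
    · simp only [hl, add_apply, smul_apply, smul_eq_mul]
      ring
  have hF₃ := hcmp α β hβ (hfin _ (by simp))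
  have hF₄ := hcmp γ δ hδ (hfin _ (by simp))
  set μ := γ * β / (α * δ) with hμ
  refine isAlgebraic_of_almost_dilation (a := fun t => l₁ (p t)) (K := ‖l₁‖ * K) (μ := μ) ?_ ?_ ?_
  · intro t
    simpa [h₁₁] using hp l₁ t
  · refine (hfin l₁ (by simp) (‖l₁‖ * K + ‖l₁‖ * K + 1)).subset ?_
    rintro _ ⟨t, s, hts, rfl⟩
    refine ⟨?_, _, hpS t, _, hpS s, rfl⟩
    have := two _ _ _ _ _ _ (hp l₁ t) (hp l₁ s)
    rw [h₁₁, mul_one, mul_one] at this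
    linarith
  · refine ((hF₄.prod hF₃).image fun z => β / (α * δ) * z.1 - z.2 / α).subset ?_
    rintro _ ⟨t, rfl⟩
    refine ⟨(_, _), ⟨⟨t, rfl⟩, ⟨μ * t, rfl⟩⟩, ?_⟩
    have : α * (μ * t) / β = γ * t / δ := by
      rw [hμ]; field_simp
    simp only [this]
    rw [hμ]
    field_simp
    ring
end

/-! ### Sides and their slopes -/

section
variable {X : Type*} [NormedAddCommGroup X] [NormedSpace ℝ X]

theorem IsSide.norm_eq_one {I : Set X} (hI : IsSide (Metric.closedBall (0 : X) 1) I) {x : X}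
    (hx : x ∈ I) : ‖x‖ = 1 := by
  have := hI.2.1 hx
  rwa [frontier_closedBall _ one_ne_zero, mem_sphere_zero_iff_norm] at this

/-- A norming functional of the midpoint of a side is constant on the side. -/
theorem IsNormingSet.exists_eq_one_on_side {L : Set (X →L[ℝ] ℝ)} (hL : IsNormingSet L) {I : Set X}
    (hI : IsSide (Metric.closedBall (0 : X) 1) I) : ∃ f ∈ L, ∀ x ∈ I, f x = 1 := by
  obtain ⟨p, q, -, rfl⟩ := hI.1
  have hp := hI.norm_eq_one (left_mem_segment ℝ p q)
  have hq := hI.norm_eq_one (right_mem_segment ℝ p q)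
  have hm : (1 / 2 : ℝ) • p + (1 / 2 : ℝ) • q ∈ segment ℝ p q :=
    ⟨1 / 2, 1 / 2, by norm_num, by norm_num, by norm_num, rfl⟩
  obtain ⟨f, hf, hfm⟩ := hL.exists_eq ((1 / 2 : ℝ) • p + (1 / 2 : ℝ) • q)
  rw [hI.norm_eq_one hm, map_add, map_smul, map_smul, smul_eq_mul, smul_eq_mul] at hfm
  have h1 := hL.le_norm f hf p
  have h2 := hL.le_norm f hf q
  refine ⟨f, hf, ?_⟩
  rintro _ ⟨a, b, -, -, hab, rfl⟩
  have hfp : f p = 1 := by linarith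
  have hfq : f q = 1 := by linarith
  rw [map_add, map_smul, map_smul, hfp, hfq, smul_eq_mul, smul_eq_mul, mul_one, mul_one, hab]

theorem apply_eq_repr (e : Module.Basis (Fin 2) ℝ X) (f : X →L[ℝ] ℝ) (x : X) :
    f x = f (e 0) * e.repr x 0 + f (e 1) * e.repr x 1 := by
  have h := congrArg f (e.sum_repr x)
  rw [Fin.sum_univ_two, map_add, map_smul, map_smul, smul_eq_mul, smul_eq_mul] at h
  rw [← h]
  ring

theorem hasSlope_of_eq_one (e : Module.Basis (Fin 2) ℝ X) {f : X →L[ℝ] ℝ} {I : Set X}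
    (hne : I.Nonempty) (hI : ∀ x ∈ I, f x = 1) : HasSlope e I (lineSlope (f (e 0)) (f (e 1))) := by
  refine ⟨_, _, -1, ?_, fun x hx => ?_, rfl⟩
  · by_contra! h
    obtain ⟨x, hx⟩ := hne
    have := hI x hx
    rw [apply_eq_repr e, h.1, h.2] at this
    simp at this
  · rw [← apply_eq_repr, hI x hx]
    norm_num

theorem isAlgebraicSlope_lineSlope {u₁ u₂ : ℝ} (h : u₂ ≠ 0 → IsAlgebraic ℚ (u₁ / u₂)) :
    IsAlgebraicSlope (lineSlope u₁ u₂) := by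
  unfold lineSlope
  split_ifs with h0
  · exact Or.inl rfl
  · refine Or.inr ⟨_, rfl, ?_⟩
    rw [neg_div]
    exact (h h0).neg

theorem exists_basis_pair (hX : Module.finrank ℝ X = 2) {a b : X}
    (hab : ∀ s t : ℝ, s • a + t • b = 0 → s = 0 ∧ t = 0) :
    ∃ e : Module.Basis (Fin 2) ℝ X, e 0 = a ∧ e 1 = b := by
  have hli : LinearIndependent ℝ ![a, b] := LinearIndependent.pair_iff.2 hab
  refine ⟨basisOfLinearIndependentOfCardEqFinrank hli (by simp [hX]), ?_, ?_⟩ <;> simp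

/-- Two functionals of a norming set of a plane form a basis of the dual. -/
theorem IsNormingSet.exists_dual_pair (hX : Module.finrank ℝ X = 2) {L : Set (X →L[ℝ] ℝ)}
    (hL : IsNormingSet L) : ∃ l₁ ∈ L, ∃ l₂ ∈ L, ∃ e₁ e₂ : X,
      l₁ e₁ = 1 ∧ l₁ e₂ = 0 ∧ l₂ e₁ = 0 ∧ l₂ e₂ = 1 := by
  have : Nontrivial X := Module.nontrivial_of_finrank_pos (R := ℝ) (by omega)
  have : FiniteDimensional ℝ X := Module.finite_of_finrank_pos (by omega)
  obtain ⟨x, hx⟩ := exists_ne (0 : X)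
  obtain ⟨l₁, hl₁, h1⟩ := hL.exists_eq x
  have hker : LinearMap.ker (l₁ : X →ₗ[ℝ] ℝ) ≠ ⊥ :=
    LinearMap.ker_ne_bot_of_finrank_lt (by rw [hX, Module.finrank_self]; norm_num)
  obtain ⟨y, hy, hy0⟩ := Submodule.exists_mem_ne_zero_of_ne_bot hker
  have hy' : l₁ y = 0 := hy
  obtain ⟨l₂, hl₂, h2⟩ := hL.exists_eq y
  have hxn : ‖x‖ ≠ 0 := norm_ne_zero_iff.2 hx
  have hyn : ‖y‖ ≠ 0 := norm_ne_zero_iff.2 hy0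
  refine ⟨l₁, hl₁, l₂, hl₂, ‖x‖⁻¹ • x - (‖x‖⁻¹ * l₂ x * ‖y‖⁻¹) • y, ‖y‖⁻¹ • y, ?_, ?_, ?_, ?_⟩
  · simp [h1, hy', hxn]
  · simp [hy']
  · simp [h2, hyn]
  · simp [h2, hyn]

theorem isFinitePolygon_and_slopes_of_linearGrowth (hX : Module.finrank ℝ X = 2) {S : Set X}
    (hS : IsWellDistributed S) (hgrowth : HasLinearDistanceGrowth S) :
    IsFinitePolygon (Metric.closedBall (0 : X) 1) ∧
      ∃ e : Module.Basis (Fin 2) ℝ X, ∀ I : Set X, IsSide (Metric.closedBall (0 : X) 1) I →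
        ∃ s : OnePoint ℝ, HasSlope e I s ∧ IsAlgebraicSlope s := by
  have : Nontrivial X := Module.nontrivial_of_finrank_pos (R := ℝ) (by omega)
  have : FiniteDimensional ℝ X := Module.finite_of_finrank_pos (by omega)
  obtain ⟨K, hK⟩ := hS
  obtain ⟨C, hC, hD⟩ := hgrowth.exists_linearGrowth
  set L := normDerivatives X
  have hL : IsNormingSet L := isNormingSet_normDerivatives (finite_normDerivatives hK hC.le hD)
  refine ⟨hL.isFinitePolygon, ?_⟩
  have hfin : ∀ f ∈ L, ∀ R : ℝ, {v : ℝ | |v| ≤ R ∧ ∃ a ∈ S, ∃ b ∈ S, v = f a - f b}.Finite := by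
    intro f hf R
    obtain ⟨u, ρ, hcone⟩ := hL.exists_isNormOnCone hf hf
    exact hcone.finite_differences hK hC.le hD R
  obtain ⟨l₁, hl₁, l₂, hl₂, e₁, e₂, h₁₁, h₁₂, h₂₁, h₂₂⟩ := hL.exists_dual_pair hX
  have hind : ∀ s t : ℝ, s • e₁ + t • e₂ = 0 → s = 0 ∧ t = 0 := by
    intro s t h
    have h1 := congrArg l₁ h
    have h2 := congrArg l₂ h
    simp only [map_add, map_smul, h₁₁, h₁₂, h₂₁, h₂₂, smul_eq_mul, map_zero] at h1 h2
    constructor <;> linarith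
  obtain ⟨e, he₁, he₂⟩ := exists_basis_pair hX hind
  have hcomb : ∀ f : X →L[ℝ] ℝ, f = f e₁ • l₁ + f e₂ • l₂ := by
    intro f
    apply ContinuousLinearMap.coe_injective
    refine e.ext fun i => ?_
    fin_cases i <;> simp [he₁, he₂, h₁₁, h₁₂, h₂₁, h₂₂]
  by_cases h : ∃ l₃ ∈ L, l₃ e₁ ≠ 0 ∧ l₃ e₂ ≠ 0
  · -- the coordinates in which `l₃` is the sum of the coordinates
    obtain ⟨l₃, hl₃, hα, hβ⟩ := h
    set α := l₃ e₁ with hα'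
    set β := l₃ e₂ with hβ'
    obtain ⟨e', he₁', he₂'⟩ := exists_basis_pair hX (a := α⁻¹ • e₁) (b := β⁻¹ • e₂) (by
      intro s t hst
      rw [smul_smul, smul_smul] at hst
      simpa [hα, hβ] using hind _ _ hst)
    refine ⟨e', fun I hI => ?_⟩
    obtain ⟨f, hf, hf1⟩ := hL.exists_eq_one_on_side hI
    have hne : I.Nonempty := by
      obtain ⟨p, q, -, rfl⟩ := hI.1
      exact ⟨p, left_mem_segment ℝ p q⟩
    refine ⟨_, hasSlope_of_eq_one e' hne hf1, isAlgebraicSlope_lineSlope fun h0 => ?_⟩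
    rw [he₁', he₂', map_smul, map_smul, smul_eq_mul, smul_eq_mul] at *
    have hδ : f e₂ ≠ 0 := right_ne_zero_of_mul h0
    have := isAlgebraic_of_finite_differences hK h₁₁ h₁₂ h₂₁ h₂₂ hα hβ (γ := f e₁) hδ (by
      intro g hg
      rw [← hcomb f, hα', hβ', ← hcomb l₃] at hg
      rcases hg with rfl | rfl | rfl | rfl
      exacts [hfin _ hl₁, hfin _ hl₂, hfin _ hl₃, hfin _ hf])
    convert this using 1
    field_simp
  · push Not at h
    refine ⟨e, fun I hI => ?_⟩
    obtain ⟨f, hf, hf1⟩ := hL.exists_eq_one_on_side hI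
    have hne : I.Nonempty := by
      obtain ⟨p, q, -, rfl⟩ := hI.1
      exact ⟨p, left_mem_segment ℝ p q⟩
    refine ⟨_, hasSlope_of_eq_one e hne hf1, isAlgebraicSlope_lineSlope fun h0 => ?_⟩
    rw [he₁, he₂] at *
    have : f e₁ = 0 := by
      by_contra h1
      exact h0 (h f hf h1)
    rw [this, zero_div]
    exact isAlgebraic_zero

/-! ### Functionals of the sides of a polygonal ball -/

/-- The part of the unit sphere on the line through `p` and `q` is a side. -/
theorem exists_isSide {f : X →L[ℝ] ℝ} (hf : ∀ x, f x ≤ ‖x‖) {p q : X} (hpq : p ≠ q)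
    (hp : ‖p‖ ≤ 1) (hq : ‖q‖ ≤ 1) (hfp : f p = 1) (hfq : f q = 1) :
    ∃ I, IsSide (Metric.closedBall (0 : X) 1) I ∧ p ∈ I ∧ q ∈ I := by
  set γ := AffineMap.lineMap (k := ℝ) p q with hγ
  have hγapp : ∀ s : ℝ, γ s = p + s • (q - p) := fun s => by
    rw [hγ, AffineMap.lineMap_apply_module']; abel
  have hγc : Continuous γ := by
    have : (γ : ℝ → X) = fun s => p + s • (q - p) := funext hγapp
    rw [this]; fun_prop
  have hd : 0 < ‖q - p‖ := norm_pos_iff.2 (sub_ne_zero.2 hpq.symm)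
  set J : Set ℝ := γ ⁻¹' Metric.closedBall (0 : X) 1 with hJ
  have hJcl : IsClosed J := Metric.isClosed_closedBall.preimage hγc
  have hJb : J ⊆ Metric.closedBall 0 (2 / ‖q - p‖) := by
    intro s hs
    have h1 : ‖p + s • (q - p)‖ ≤ 1 := by
      rw [← hγapp]; exact mem_closedBall_zero_iff.1 hs
    rw [mem_closedBall_zero_iff, le_div_iff₀ hd, ← norm_smul]
    have h2 := norm_sub_le (p + s • (q - p)) p
    rw [add_sub_cancel_left] at h2
    linarith
  have hJcomp : IsCompact J := (isCompact_closedBall _ _).of_isClosed_subset hJcl hJb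
  have hJconv : Convex ℝ J := (convex_closedBall (0 : X) 1).affine_preimage γ
  have h0 : (0 : ℝ) ∈ J := by simp [hJ, hγ, hp]
  have h1 : (1 : ℝ) ∈ J := by simp [hJ, hγ, hq]
  have hJcon : IsConnected J := ⟨⟨0, h0⟩, hJconv.isPreconnected⟩
  have hIcc := eq_Icc_of_connected_compact hJcon hJcomp
  set a := sInf J
  set b := sSup J
  have hab : a < b := by
    rw [hIcc] at h0 h1
    linarith [h0.1, h1.2]
  have hI : segment ℝ (γ a) (γ b) = γ '' J := by
    rw [← image_segment ℝ γ a b, segment_eq_Icc hab.le, ← hIcc]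
  have hpI : p ∈ segment ℝ (γ a) (γ b) := hI ▸ ⟨0, h0, by simp [hγ]⟩
  have hqI : q ∈ segment ℝ (γ a) (γ b) := hI ▸ ⟨1, h1, by simp [hγ]⟩
  refine ⟨segment ℝ (γ a) (γ b), ⟨⟨_, _, ?_, rfl⟩, ?_, ?_⟩, hpI, hqI⟩
  · intro h
    exact hab.ne ((AffineMap.lineMap_injective ℝ hpq) h)
  · rw [hI, frontier_closedBall _ one_ne_zero]
    rintro _ ⟨s, hs, rfl⟩
    rw [mem_sphere_zero_iff_norm]
    refine le_antisymm (mem_closedBall_zero_iff.1 hs) ?_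
    refine le_trans (le_of_eq ?_) (hf (γ s))
    rw [hγapp, map_add, map_smul, map_sub, hfp, hfq, sub_self, smul_zero, add_zero]
  · intro p' q' hsub hfr
    refine Set.Subset.antisymm (fun x hx => ?_) hsub
    have hx1 : ‖x‖ ≤ 1 := by
      have := hfr hx
      rw [frontier_closedBall _ one_ne_zero, mem_sphere_zero_iff_norm] at this
      exact this.le
    obtain ⟨r, -, hr⟩ := (segment_eq_image' ℝ p' q' ▸ hx :)
    obtain ⟨r₁, -, hr₁⟩ := (segment_eq_image' ℝ p' q' ▸ hsub hpI :)
    obtain ⟨r₂, -, hr₂⟩ := (segment_eq_image' ℝ p' q' ▸ hsub hqI :)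
    simp only at hr hr₁ hr₂
    have hne : r₂ - r₁ ≠ 0 := by
      intro h
      apply hpq
      rw [← hr₁, ← hr₂, sub_eq_zero.1 h]
    have hxγ : x = γ ((r - r₁) / (r₂ - r₁)) := by
      have e1 : q - p = (r₂ - r₁) • (q' - p') := by rw [← hr₁, ← hr₂]; module
      rw [hγapp, e1, smul_smul, div_mul_cancel₀ _ hne, ← hr, ← hr₁]
      module
    rw [hI]
    refine ⟨_, ?_, hxγ.symm⟩
    rw [hJ, Set.mem_preimage, ← hxγ]
    exact mem_closedBall_zero_iff.2 hx1

/-- A functional taking the value `1` at two points of an algebraic slope is a real multiple of a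
functional with algebraic coefficients. -/
theorem exists_algebraic_coeffs (e : Module.Basis (Fin 2) ℝ X) {I : Set X} {s : OnePoint ℝ}
    (hs : HasSlope e I s) (halg : IsAlgebraicSlope s) {f : X →L[ℝ] ℝ} {p q : X} (hpq : p ≠ q)
    (hp : p ∈ I) (hq : q ∈ I) (hf : f p = f q) :
    ∃ c α β : ℝ, IsAlgebraic ℚ α ∧ IsAlgebraic ℚ β ∧
      ∀ x, f x = c * (α * e.repr x 0 + β * e.repr x 1) := by
  obtain ⟨u₁, u₂, u₀, hu, hI, rfl⟩ := hs
  have h1 : u₁ * (e.repr p 0 - e.repr q 0) + u₂ * (e.repr p 1 - e.repr q 1) = 0 := by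
    linarith [hI p hp, hI q hq]
  have h2 : f (e 0) * (e.repr p 0 - e.repr q 0) + f (e 1) * (e.repr p 1 - e.repr q 1) = 0 := by
    rw [apply_eq_repr e f p, apply_eq_repr e f q] at hf
    linarith
  have hd : e.repr p 0 - e.repr q 0 ≠ 0 ∨ e.repr p 1 - e.repr q 1 ≠ 0 := by
    by_contra! h
    apply hpq
    apply e.repr.injective
    ext i
    fin_cases i
    · exact sub_eq_zero.1 h.1
    · exact sub_eq_zero.1 h.2
  have hprop : f (e 0) * u₂ = f (e 1) * u₁ := by
    rcases hd with hd | hd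
    · refine mul_right_cancel₀ hd ?_
      linear_combination u₂ * h2 - f (e 1) * h1
    · refine mul_right_cancel₀ hd ?_
      linear_combination f (e 0) * h1 - u₁ * h2
  by_cases h0 : u₂ = 0
  · have hu₁ : u₁ ≠ 0 := by simpa [h0] using hu
    have hf1 : f (e 1) = 0 := by simpa [h0, hu₁] using hprop
    refine ⟨f (e 0), 1, 0, isAlgebraic_one, isAlgebraic_zero, fun x => ?_⟩
    rw [apply_eq_repr e f x, hf1]
    ring
  · have hr : IsAlgebraic ℚ (-u₁ / u₂) := by
      rcases halg with h | ⟨r, hr, hra⟩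
      · simp [lineSlope, h0] at h
      · simp only [lineSlope, h0, if_false] at hr
        rwa [OnePoint.coe_injective hr]
    refine ⟨f (e 1), -(-u₁ / u₂), 1, hr.neg, isAlgebraic_one, fun x => ?_⟩
    have : f (e 0) = f (e 1) * u₁ / u₂ := by rw [← hprop, mul_div_cancel_right₀ _ h0]
    rw [apply_eq_repr e f x, this]
    ring

theorem eq_of_apply_eq_one (hX : Module.finrank ℝ X = 2) {f g : X →L[ℝ] ℝ} {p q : X} (hpq : p ≠ q)
    (hfp : f p = 1) (hfq : f q = 1) (hgp : g p = 1) (hgq : g q = 1) : f = g := by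
  obtain ⟨e, he₁, he₂⟩ := exists_basis_pair hX (a := p) (b := q) (by
    intro s t h
    have h1 := congrArg f h
    simp only [map_add, map_smul, hfp, hfq, smul_eq_mul, mul_one, map_zero] at h1
    have h2 : s • (p - q) = 0 := by
      rw [← h, show t = -s by linarith]; module
    have hs : s = 0 := (smul_eq_zero.1 h2).resolve_right (sub_ne_zero.2 hpq)
    exact ⟨hs, by linarith⟩)
  apply ContinuousLinearMap.coe_injective
  refine e.ext fun i => ?_
  fin_cases i <;> simp [he₁, he₂, hfp, hfq, hgp, hgq]

/-- The functionals that take the value `1` on a side of a polygonal unit ball form a norming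
set. -/
theorem IsFinitePolygon.exists_isNormingSet (hX : Module.finrank ℝ X = 2)
    (hP : IsFinitePolygon (Metric.closedBall (0 : X) 1)) :
    ∃ L : Set (X →L[ℝ] ℝ), IsNormingSet L ∧ ∀ f ∈ L, ∃ p q : X, p ≠ q ∧ f p = 1 ∧ f q = 1 ∧
      ∃ I, IsSide (Metric.closedBall (0 : X) 1) I ∧ p ∈ I ∧ q ∈ I := by
  have : FiniteDimensional ℝ X := Module.finite_of_finrank_pos (by omega)
  obtain ⟨⟨V, hV, hball⟩, -⟩ := hP
  have hVball : ∀ v ∈ V, ‖v‖ ≤ 1 := fun v hv => by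
    rw [← mem_closedBall_zero_iff, hball]
    exact subset_convexHull ℝ V hv
  have hVne : V.Nonempty := by
    rw [← convexHull_nonempty_iff (𝕜 := ℝ), ← hball]
    exact ⟨0, by simp⟩
  set L : Set (X →L[ℝ] ℝ) := {f | (∀ x, f x ≤ ‖x‖) ∧ ∃ p ∈ V, ∃ q ∈ V, p ≠ q ∧ f p = 1 ∧ f q = 1}
    with hL
  have hfin : L.Finite := by
    have : L ⊆ ⋃ z ∈ V ×ˢ V, {f : X →L[ℝ] ℝ | z.1 ≠ z.2 ∧ f z.1 = 1 ∧ f z.2 = 1} := by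
      rintro f ⟨-, p, hp, q, hq, h⟩
      exact Set.mem_biUnion (x := (p, q)) ⟨hp, hq⟩ h
    refine ((hV.prod hV).biUnion fun z _ => Set.Subsingleton.finite ?_).subset this
    rintro f ⟨hne, hf1, hf2⟩ g ⟨-, hg1, hg2⟩
    exact eq_of_apply_eq_one hX hne hf1 hf2 hg1 hg2
  refine ⟨L, .of_dense hfin (fun f hf => hf.1) ?_, ?_⟩
  · -- directions of the vertices are negligible
    borelize X
    have hae : ∀ᵐ x ∂(MeasureTheory.Measure.addHaar : MeasureTheory.Measure X),
        ∀ v ∈ V, x ∉ Submodule.span ℝ {v} := by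
      rw [MeasureTheory.ae_ball_iff hV.countable]
      intro v _
      refine MeasureTheory.measure_eq_zero_iff_ae_notMem.1
        (MeasureTheory.Measure.addHaar_submodule _ _ fun h => ?_)
      have := finrank_span_le_card (R := ℝ) ({v} : Set X)
      rw [h, finrank_top, hX] at this
      simp at this
    refine (MeasureTheory.Measure.dense_of_ae hae).mono fun x hx => ?_
    have hx0 : x ≠ 0 := by
      rintro rfl
      obtain ⟨v, hv⟩ := hVne
      exact hx v hv (Submodule.zero_mem _)
    have hxn : ‖x‖ ≠ 0 := norm_ne_zero_iff.2 hx0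
    obtain ⟨f, hf1, hfx⟩ := exists_dual_vector ℝ x hxn
    have hfle : ∀ y, f y ≤ ‖y‖ := fun y =>
      (le_abs_self _).trans ((f.le_opNorm y).trans (by rw [hf1, one_mul]))
    have hfx' : f x = ‖x‖ := by simpa using hfx
    refine ⟨f, ⟨hfle, ?_⟩, hfx'⟩
    have hy : ‖x‖⁻¹ • x ∈ convexHull ℝ (hV.toFinset : Set X) := by
      rw [hV.coe_toFinset, ← hball, mem_closedBall_zero_iff, norm_smul, norm_inv, norm_norm,
        inv_mul_cancel₀ hxn]
    obtain ⟨w, hw0, hw1, hwx⟩ := Finset.mem_convexHull'.1 hy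
    have hzero : ∀ v ∈ hV.toFinset, w v * (1 - f v) = 0 := by
      refine (Finset.sum_eq_zero_iff_of_nonneg fun v hv => ?_).1 ?_
      · have := (hfle v).trans (hVball v (hV.mem_toFinset.1 hv))
        exact mul_nonneg (hw0 v hv) (by linarith)
      · have h1 := congrArg f hwx
        rw [map_sum, map_smul, hfx', smul_eq_mul, inv_mul_cancel₀ hxn] at h1
        simp only [map_smul, smul_eq_mul] at h1
        simp only [mul_sub, mul_one, Finset.sum_sub_distrib, hw1, h1, sub_self]
    by_contra! hcon
    obtain ⟨v₀, hv₀, hwv₀⟩ : ∃ v ∈ hV.toFinset, w v ≠ 0 := by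
      by_contra! h
      rw [Finset.sum_eq_zero h] at hw1
      exact zero_ne_one hw1
    have hone : ∀ v ∈ hV.toFinset, w v ≠ 0 → f v = 1 := fun v hv h => by
      linarith [(mul_eq_zero.1 (hzero v hv)).resolve_left h]
    have hsum : ∑ v ∈ hV.toFinset, w v • v = w v₀ • v₀ := by
      refine Finset.sum_eq_single_of_mem v₀ hv₀ fun v hv hne => ?_
      by_contra h
      have hwv : w v ≠ 0 := fun h0 => h (by rw [h0, zero_smul])
      exact hcon v (hV.mem_toFinset.1 hv) v₀ (hV.mem_toFinset.1 hv₀) hne (hone v hv hwv)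
        (hone v₀ hv₀ hwv₀)
    refine hx v₀ (hV.mem_toFinset.1 hv₀) (Submodule.mem_span_singleton.2 ⟨‖x‖ * w v₀, ?_⟩)
    rw [mul_smul, ← hsum, hwx, smul_smul, mul_inv_cancel₀ hxn, one_smul]
  · rintro f ⟨hfle, p, hp, q, hq, hne, hfp, hfq⟩
    exact ⟨p, q, hne, hfp, hfq, exists_isSide hfle hne (hVball p hp) (hVball q hq) hfp hfq⟩
end

/-! ### Operations on sets of linear growth -/

theorem LinearGrowth.mono {D D' : Set ℝ} {C : ℝ} (h : LinearGrowth D C) (hsub : D' ⊆ D) :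
    LinearGrowth D' C := fun N hN => by
  obtain ⟨h1, h2⟩ := h N hN
  have h3 : D' ∩ Set.Iic (N : ℝ) ⊆ D ∩ Set.Iic (N : ℝ) := Set.inter_subset_inter_left _ hsub
  exact ⟨h1.subset h3, (Nat.cast_le.2 (Set.ncard_le_ncard h3 h1)).trans h2⟩

theorem LinearGrowth.union {D D' : Set ℝ} {C C' : ℝ} (h : LinearGrowth D C)
    (h' : LinearGrowth D' C') : LinearGrowth (D ∪ D') (C + C') := fun N hN => by
  obtain ⟨h1, h2⟩ := h N hN
  obtain ⟨h1', h2'⟩ := h' N hN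
  rw [Set.union_inter_distrib_right]
  refine ⟨h1.union h1', ?_⟩
  calc _ ≤ (((D ∩ Set.Iic (N : ℝ)).ncard + (D' ∩ Set.Iic (N : ℝ)).ncard : ℕ) : ℝ) :=
        Nat.cast_le.2 (Set.ncard_union_le _ _)
    _ ≤ _ := by push_cast; linarith

theorem exists_linearGrowth_biUnion {ι : Type*} {L : Set ι} (hL : L.Finite) {D : ι → Set ℝ}
    (h : ∀ f ∈ L, ∃ C, LinearGrowth (D f) C) : ∃ C, LinearGrowth (⋃ f ∈ L, D f) C := by
  induction L, hL using Set.Finite.induction_on with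
  | empty => exact ⟨0, fun N _ => by simp⟩
  | @insert a s _ _ ih =>
    obtain ⟨C, hC⟩ := ih fun f hf => h f (Set.mem_insert_of_mem _ hf)
    obtain ⟨C', hC'⟩ := h a (Set.mem_insert _ _)
    rw [Set.biUnion_insert]
    exact ⟨_, hC'.union hC⟩

theorem LinearGrowth.hasLinearDistanceGrowth {X : Type*} [NormedAddCommGroup X] {S : Set X} {C : ℝ}
    (h : LinearGrowth (allDistances S) C) : HasLinearDistanceGrowth S := by
  constructor
  · intro N
    rw [distanceSet_eq]
    exact h.finite N
  · refine IsBigO.of_bound C (eventually_atTop.2 ⟨1, fun N hN => ?_⟩)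
    rw [distanceSet_eq, Real.norm_natCast, Real.norm_natCast]
    exact (h N hN).2

/-! ### Algebraic integers with bounded conjugates -/

section NumberField
open NumberField
variable {K : Type*} [Field K]

/-- The infinite place of the real embedding `σ`. -/
noncomputable def realPlace (σ : K →+* ℝ) : InfinitePlace K :=
  InfinitePlace.mk (Complex.ofRealHom.comp σ)

theorem realPlace_apply (σ : K →+* ℝ) (x : K) : realPlace σ x = |σ x| := by
  simp [realPlace, InfinitePlace.apply]

theorem isReal_ofRealHom_comp (σ : K →+* ℝ) :
    ComplexEmbedding.IsReal (Complex.ofRealHom.comp σ) := by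
  ext x
  simp [ComplexEmbedding.conjugate_coe_eq]

theorem isReal_realPlace (σ : K →+* ℝ) : (realPlace σ).IsReal :=
  ⟨_, isReal_ofRealHom_comp σ, rfl⟩

theorem mixedEmbedding_realPlace (σ : K →+* ℝ) (x : K) :
    (mixedEmbedding K x).1 ⟨realPlace σ, isReal_realPlace σ⟩ = σ x := by
  rw [mixedEmbedding.mixedEmbedding_apply_isReal]
  apply Complex.ofReal_injective
  rw [InfinitePlace.embedding_of_isReal_apply]
  simp only [realPlace]
  rw [InfinitePlace.embedding_mk_eq_of_isReal (isReal_ofRealHom_comp σ)]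
  rfl

theorem place_add_le (w : InfinitePlace K) (x y : K) : w (x + y) ≤ w x + w y := by
  simp only [← w.norm_embedding_eq, map_add]
  exact norm_add_le _ _

theorem place_sub_le (w : InfinitePlace K) (x y : K) : w (x - y) ≤ w x + w y := by
  simp only [← w.norm_embedding_eq, map_sub]
  exact norm_sub_le _ _

variable [NumberField K]

/-- The algebraic integers whose absolute values at all places but that of `σ` are at most `B` have
`σ`-values at bounded distance from every real number: round off the point of the mixed space with
`σ`-coordinate `t` and all other coordinates zero to the lattice of integers. -/
theorem exists_integer_near (σ : K →+* ℝ) : ∃ B : ℝ, ∀ t : ℝ, ∃ z : 𝓞 K,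
    |t - σ z| ≤ B ∧ ∀ w : InfinitePlace K, w ≠ realPlace σ → w (z : K) ≤ B := by
  classical
  set b := mixedEmbedding.latticeBasis K
  refine ⟨∑ i, ‖b i‖, fun t => ?_⟩
  set w₀ : {w : InfinitePlace K // w.IsReal} := ⟨realPlace σ, isReal_realPlace σ⟩ with hw₀
  set v : mixedEmbedding.mixedSpace K := (Pi.single w₀ t, 0) with hv
  have hfl := (mixedEmbedding.mem_span_latticeBasis K).1 (ZSpan.floor b v).2
  obtain ⟨z, hz⟩ : ∃ z : 𝓞 K, mixedEmbedding K (z : K) =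
      (ZSpan.floor b v : mixedEmbedding.mixedSpace K) := by
    obtain ⟨z, hz⟩ := hfl
    exact ⟨z, hz⟩
  have hnorm : ‖v - mixedEmbedding K (z : K)‖ ≤ ∑ i, ‖b i‖ := by
    rw [hz, ← ZSpan.fract_apply]
    exact ZSpan.norm_fract_le b v
  refine ⟨z, ?_, fun w hw => ?_⟩
  · have h1 := ((norm_le_pi_norm _ w₀).trans (norm_fst_le _)).trans hnorm
    have hv₀ : v.1 w₀ = t := by simp [hv]
    rw [Prod.fst_sub, Pi.sub_apply, hv₀, mixedEmbedding_realPlace, Real.norm_eq_abs] at h1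
    exact h1
  · rw [← mixedEmbedding.normAtPlace_apply]
    rcases w.isReal_or_isComplex with h | h
    · rw [mixedEmbedding.normAtPlace_apply_of_isReal h]
      have h1 := ((norm_le_pi_norm _ ⟨w, h⟩).trans (norm_fst_le _)).trans hnorm
      have hne : (⟨w, h⟩ : {w : InfinitePlace K // w.IsReal}) ≠ w₀ := fun h' =>
        hw (congrArg Subtype.val h')
      simpa [hv, hne] using h1
    · rw [mixedEmbedding.normAtPlace_apply_of_isComplex h]
      have h1 := ((norm_le_pi_norm _ ⟨w, h⟩).trans (norm_snd_le _)).trans hnorm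
      simpa [hv] using h1

/-- The number of algebraic integers with bounded absolute values at all places but that of `σ` and
`σ`-value in `[-N, N]` is `O(N)`: those with the same integer part of the `σ`-value differ from one
of them by elements of a fixed finite set. -/
theorem exists_integer_count (σ : K →+* ℝ) (B : ℝ) : ∃ C : ℝ, ∀ N : ℝ, 1 ≤ N →
    {z : 𝓞 K | |σ z| ≤ N ∧ ∀ w : InfinitePlace K, w ≠ realPlace σ → w (z : K) ≤ B}.Finite ∧
    ({z : 𝓞 K | |σ z| ≤ N ∧ ∀ w : InfinitePlace K, w ≠ realPlace σ → w (z : K) ≤ B}.ncard : ℝ)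
      ≤ C * N := by
  classical
  have hfinite : ∀ M : ℝ, {z : 𝓞 K | ∀ w : InfinitePlace K, w (z : K) ≤ M}.Finite := by
    intro M
    refine Set.Finite.of_finite_image (f := fun z : 𝓞 K => (z : K))
      ((Embeddings.finite_of_norm_le K ℂ M).subset ?_)
      (RingOfIntegers.coe_injective.injOn)
    rintro _ ⟨z, hz, rfl⟩
    exact ⟨z.isIntegral_coe, fun φ => hz (InfinitePlace.mk φ)⟩
  set F := (hfinite (max 1 (B + B))).toFinset with hF
  refine ⟨F.card * 5, fun N hN => ?_⟩
  set A := {z : 𝓞 K | |σ z| ≤ N ∧ ∀ w : InfinitePlace K, w ≠ realPlace σ → w (z : K) ≤ B} with hA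
  have hAfin : A.Finite := by
    refine (hfinite (max N B)).subset fun z hz w => ?_
    by_cases hw : w = realPlace σ
    · rw [hw, realPlace_apply]
      exact hz.1.trans (le_max_left _ _)
    · exact (hz.2 w hw).trans (le_max_right _ _)
  refine ⟨hAfin, ?_⟩
  have hcard : hAfin.toFinset.card ≤ F.card * (Finset.Icc (-⌈N⌉) ⌈N⌉).card := by
    refine Finset.card_le_mul_card_image_of_maps_to (f := fun z : 𝓞 K => ⌊σ z⌋) (fun z hz => ?_) _
      fun m _ => ?_
    · have h1 := abs_le.1 ((hAfin.mem_toFinset.1 hz).1)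
      rw [Finset.mem_Icc]
      refine ⟨Int.le_floor.2 ?_, ?_⟩
      · push_cast
        linarith [Int.le_ceil N]
      · exact_mod_cast ((Int.floor_le _).trans h1.2).trans (Int.le_ceil N)
    · rcases Finset.eq_empty_or_nonempty
          (hAfin.toFinset.filter fun z : 𝓞 K => ⌊σ z⌋ = m) with he | ⟨z₀, hz₀⟩
      · rw [he, Finset.card_empty]
        exact Nat.zero_le _
      · obtain ⟨hz₀A, hz₀m⟩ := Finset.mem_filter.1 hz₀
        refine Finset.card_le_card_of_injOn (fun z : 𝓞 K => z - z₀) (fun z hz => ?_)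
          (fun z _ z' _ h => sub_left_injective h)
        obtain ⟨hzA, hzm⟩ := Finset.mem_filter.1 (Finset.mem_coe.1 hz)
        refine (hfinite _).mem_toFinset.2 fun w => ?_
        have hsub : ((z - z₀ : 𝓞 K) : K) = (z : K) - (z₀ : K) := map_sub (algebraMap (𝓞 K) K) z z₀
        rw [hsub]
        by_cases hw : w = realPlace σ
        · refine le_trans ?_ (le_max_left _ _)
          rw [hw, realPlace_apply, map_sub]
          exact (Int.abs_sub_lt_one_of_floor_eq_floor (hzm.trans hz₀m.symm)).le
        · refine le_trans ?_ (le_max_right _ _)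
          exact (place_sub_le w _ _).trans (add_le_add ((hAfin.mem_toFinset.1 hzA).2 w hw)
            ((hAfin.mem_toFinset.1 hz₀A).2 w hw))
  rw [Set.ncard_eq_toFinset_card _ hAfin]
  have hN' : ((Finset.Icc (-⌈N⌉) ⌈N⌉).card : ℝ) ≤ 5 * N := by
    have h0 : (0 : ℤ) ≤ ⌈N⌉ + 1 - -⌈N⌉ := by
      have : 0 ≤ ⌈N⌉ := Int.ceil_nonneg (by linarith)
      omega
    have h1 : ((Finset.Icc (-⌈N⌉) ⌈N⌉).card : ℤ) = ⌈N⌉ + 1 - -⌈N⌉ := by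
      rw [Int.card_Icc, Int.toNat_of_nonneg h0]
    have h2 : ((Finset.Icc (-⌈N⌉) ⌈N⌉).card : ℝ) = ⌈N⌉ + 1 - -⌈N⌉ := by exact_mod_cast h1
    rw [h2]
    linarith [Int.ceil_lt_add_one N]
  calc (hAfin.toFinset.card : ℝ) ≤ F.card * ((Finset.Icc (-⌈N⌉) ⌈N⌉).card : ℝ) := by
        exact_mod_cast hcard
    _ ≤ F.card * (5 * N) := by gcongr
    _ = F.card * 5 * N := by ring

variable {X : Type*} [NormedAddCommGroup X] [NormedSpace ℝ X]

/-- The points whose coordinates are `σ`-values of algebraic integers of `K` with absolute values at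
most `B` at all the other places. -/
def integerNet (e : Module.Basis (Fin 2) ℝ X) (σ : K →+* ℝ) (B : ℝ) : Set X :=
  {x | ∃ z : Fin 2 → 𝓞 K, (∀ i, ∀ w : InfinitePlace K, w ≠ realPlace σ → w (z i : K) ≤ B) ∧
    ∀ i, e.repr x i = σ (z i)}

theorem exists_isWellDistributed_integerNet (e : Module.Basis (Fin 2) ℝ X) (σ : K →+* ℝ) :
    ∃ B, IsWellDistributed (integerNet e σ B) := by
  obtain ⟨B, hB⟩ := exists_integer_near σ
  choose z hz hzw using hB
  refine ⟨B, ∑ i, B * ‖e i‖, fun x => ⟨∑ i, σ (z (e.repr x i)) • e i,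
    ⟨fun i => z (e.repr x i), fun i => hzw _, fun i => ?_⟩, ?_⟩⟩
  · rw [e.repr_sum_self]
  · have hx : x - ∑ i, σ (z (e.repr x i)) • e i =
        ∑ i, (e.repr x i • e i - σ (z (e.repr x i)) • e i) := by
      rw [Finset.sum_sub_distrib, e.sum_repr]
    rw [hx]
    refine norm_sum_le_of_le _ fun i _ => ?_
    rw [← sub_smul, norm_smul]
    exact mul_le_mul_of_nonneg_right (hz _) (norm_nonneg _)

/-- A functional proportional to one with coefficients in `K` takes few values on differences of
points of the net: up to a fixed factor they are algebraic integers bounded at the other places. -/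
theorem exists_linearGrowth_integerNet (e : Module.Basis (Fin 2) ℝ X) (σ : K →+* ℝ) (B : ℝ)
    {f : X →L[ℝ] ℝ} {c : ℝ} {α β : K}
    (hf : ∀ x, f x = c * (σ α * e.repr x 0 + σ β * e.repr x 1)) :
    ∃ C, LinearGrowth {t : ℝ | 0 ≤ t ∧ ∃ a ∈ integerNet e σ B, ∃ a' ∈ integerNet e σ B,
      t = f (a - a')} C := by
  classical
  by_cases hc : c = 0
  · refine ⟨1, LinearGrowth.mono (D := {0}) (fun N hN => ?_) ?_⟩
    · have h1 : ({0} : Set ℝ) ∩ Set.Iic (N : ℝ) = {0} := by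
        rw [Set.inter_eq_left, Set.singleton_subset_iff]
        exact Set.mem_Iic.2 (Nat.cast_nonneg N)
      rw [h1, Set.ncard_singleton]
      refine ⟨Set.finite_singleton _, ?_⟩
      have : (1 : ℝ) ≤ N := by exact_mod_cast hN
      simpa using this
    · rintro t ⟨-, a, -, a', -, rfl⟩
      rw [hf, hc, zero_mul]
      rfl
  obtain ⟨m, hm, hint⟩ := exists_integral_multiples ℤ ℚ ({α, β} : Finset K)
  set a₁ : 𝓞 K := ⟨m • α, hint α (by simp)⟩
  set b₁ : 𝓞 K := ⟨m • β, hint β (by simp)⟩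
  have ha₁ : σ (a₁ : K) = m * σ α := by
    change σ (m • α) = _
    rw [zsmul_eq_mul, map_mul, map_intCast]
  have hb₁ : σ (b₁ : K) = m * σ β := by
    change σ (m • β) = _
    rw [zsmul_eq_mul, map_mul, map_intCast]
  have hmR : (m : ℝ) ≠ 0 := by exact_mod_cast hm
  set B' : ℝ := ∑ w : InfinitePlace K,
    (w (a₁ : K) * (|B| + |B|) + w (b₁ : K) * (|B| + |B|)) with hB'
  obtain ⟨C, hC⟩ := exists_integer_count σ B'
  set r : ℝ := |(m : ℝ) / c| + 1 with hr
  refine ⟨C * r, fun N hN => ?_⟩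
  have hN1 : (1 : ℝ) ≤ N := by exact_mod_cast hN
  obtain ⟨h1, h2⟩ := hC (r * N) (by nlinarith [abs_nonneg ((m : ℝ) / c)])
  set A := {z : 𝓞 K | |σ z| ≤ r * N ∧ ∀ w : InfinitePlace K, w ≠ realPlace σ → w (z : K) ≤ B'}
  have hsub : {t : ℝ | 0 ≤ t ∧ ∃ a ∈ integerNet e σ B, ∃ a' ∈ integerNet e σ B, t = f (a - a')} ∩
      Set.Iic (N : ℝ) ⊆ (fun z : 𝓞 K => c / m * σ z) '' A := by
    rintro _ ⟨⟨h0, a, ⟨z, hzw, hz⟩, a', ⟨z', hzw', hz'⟩, rfl⟩, hle⟩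
    have hy : f (a - a') = c / m * σ ((a₁ * (z 0 - z' 0) + b₁ * (z 1 - z' 1) : 𝓞 K) : K) := by
      have hcoord : ∀ i, e.repr (a - a') i = σ (z i) - σ (z' i) := fun i => by
        rw [map_sub, Finsupp.sub_apply, hz, hz']
      rw [hf, hcoord, hcoord]
      simp only [map_add, map_mul, map_sub, ha₁, hb₁]
      field_simp
    refine ⟨_, ⟨?_, fun w hw => ?_⟩, hy.symm⟩
    · have h3 : σ ((a₁ * (z 0 - z' 0) + b₁ * (z 1 - z' 1) : 𝓞 K) : K) = m / c * f (a - a') := by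
        rw [hy]; field_simp
      rw [h3, abs_mul, abs_of_nonneg h0]
      have : f (a - a') ≤ N := hle
      nlinarith [abs_nonneg ((m : ℝ) / c)]
    · have hd : ∀ i, w ((z i : K) - (z' i : K)) ≤ |B| + |B| := fun i =>
        (place_sub_le w _ _).trans (add_le_add ((hzw i w hw).trans (le_abs_self B))
          ((hzw' i w hw).trans (le_abs_self B)))
      have hB1 : w (a₁ : K) * (|B| + |B|) + w (b₁ : K) * (|B| + |B|) ≤ B' :=
        Finset.single_le_sum
          (f := fun w : InfinitePlace K => w (a₁ : K) * (|B| + |B|) + w (b₁ : K) * (|B| + |B|))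
          (fun w _ => by positivity) (Finset.mem_univ w)
      refine le_trans ?_ hB1
      simp only [map_add, map_mul, map_sub]
      refine (place_add_le w _ _).trans ?_
      rw [map_mul, map_mul]
      exact add_le_add (mul_le_mul_of_nonneg_left (hd 0) (apply_nonneg w _))
        (mul_le_mul_of_nonneg_left (hd 1) (apply_nonneg w _))
  refine ⟨(h1.image _).subset hsub, ?_⟩
  calc _ ≤ (((fun z : 𝓞 K => c / m * σ z) '' A).ncard : ℝ) :=
        Nat.cast_le.2 (Set.ncard_le_ncard hsub (h1.image _))
    _ ≤ (A.ncard : ℝ) := Nat.cast_le.2 (Set.ncard_image_le h1)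
    _ ≤ C * (r * N) := h2
    _ = C * r * N := by ring
end NumberField

/-! ### The equivalence -/

section
variable {X : Type*} [NormedAddCommGroup X] [NormedSpace ℝ X]

theorem exists_wellDistributed_linearGrowth (hX : Module.finrank ℝ X = 2)
    (hP : IsFinitePolygon (Metric.closedBall (0 : X) 1)) (e : Module.Basis (Fin 2) ℝ X)
    (he : ∀ I : Set X, IsSide (Metric.closedBall (0 : X) 1) I →
      ∃ s : OnePoint ℝ, HasSlope e I s ∧ IsAlgebraicSlope s) :
    ∃ S : Set X, IsWellDistributed S ∧ HasLinearDistanceGrowth S := by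
  obtain ⟨L, hL, hside⟩ := hP.exists_isNormingSet hX
  have hcoef : ∀ f : X →L[ℝ] ℝ, f ∈ L → ∃ c α β : ℝ, IsAlgebraic ℚ α ∧ IsAlgebraic ℚ β ∧
      ∀ x, f x = c * (α * e.repr x 0 + β * e.repr x 1) := by
    intro f hf
    obtain ⟨p, q, hpq, hfp, hfq, I, hI, hp, hq⟩ := hside f hf
    obtain ⟨s, hs, halg⟩ := he I hI
    exact exists_algebraic_coeffs e hs halg hpq hp hq (hfp.trans hfq.symm)
  choose! c α β hα hβ hf using hcoef
  set A : Set ℝ := α '' L ∪ β '' L with hA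
  have hAfin : A.Finite := (hL.finite.image _).union (hL.finite.image _)
  have := hAfin.to_subtype
  set K := IntermediateField.adjoin ℚ A
  have : FiniteDimensional ℚ K := by
    refine IntermediateField.finiteDimensional_adjoin fun x hx => ?_
    rcases hx with ⟨f, hf, rfl⟩ | ⟨f, hf, rfl⟩
    exacts [(hα f hf).isIntegral, (hβ f hf).isIntegral]
  have : NumberField K := { }
  set σ : K →+* ℝ := algebraMap K ℝ
  obtain ⟨B, hB⟩ := exists_isWellDistributed_integerNet e σ
  refine ⟨_, hB, ?_⟩
  obtain ⟨C, hC⟩ := exists_linearGrowth_biUnion hL.finite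
    (D := fun f => {t : ℝ | 0 ≤ t ∧ ∃ a ∈ integerNet e σ B, ∃ a' ∈ integerNet e σ B,
      t = f (a - a')}) (fun f hfL => by
      have hαK : α f ∈ K := IntermediateField.subset_adjoin _ _ (Or.inl ⟨f, hfL, rfl⟩)
      have hβK : β f ∈ K := IntermediateField.subset_adjoin _ _ (Or.inr ⟨f, hfL, rfl⟩)
      exact exists_linearGrowth_integerNet e σ B (c := c f) (α := ⟨α f, hαK⟩) (β := ⟨β f, hβK⟩)
        (hf f hfL))
  refine (hC.mono ?_).hasLinearDistanceGrowth
  rintro _ ⟨a, ha, a', ha', rfl⟩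
  obtain ⟨f, hfL, hfa⟩ := hL.exists_eq (a - a')
  exact Set.mem_biUnion hfL ⟨norm_nonneg _, a, ha, a', ha', hfa.symm⟩
end

theorem theorem3 (X : Type*) [NormedAddCommGroup X] [NormedSpace ℝ X]
    (hX : Module.finrank ℝ X = 2) :
    (IsFinitePolygon (Metric.closedBall (0 : X) 1) ∧
      ∃ e : Module.Basis (Fin 2) ℝ X, ∀ I : Set X, IsSide (Metric.closedBall (0 : X) 1) I →
        ∃ s : OnePoint ℝ, HasSlope e I s ∧ IsAlgebraicSlope s) ↔
    ∃ S : Set X, IsWellDistributed S ∧ HasLinearDistanceGrowth S := by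
  constructor
  · rintro ⟨hP, e, he⟩
    exact exists_wellDistributed_linearGrowth hX hP e he
  · rintro ⟨S, hS, hgrowth⟩
    exact isFinitePolygon_and_slopes_of_linearGrowth hX hS hgrowth
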